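/- **Setting.** There are $K\ge 2$ arms. The mean rewards $\mu_1,\dots,\mu_K\in[0,1]$ are independent, $\mu_i\sim\mathcal P_i=\mathrm{Beta}(a_i,b_i)$ with real $a_i,b_i>0$; given $(\mu_i)$, all samples of all arms are independent, those of arm $i$ being Bernoulli with mean $\mu_i$. Write $\mu_i^0=\mathbb E[\mu_i]$; arms are ordered so that $\mu_1^0\ge\dots\ge\mu_K^0$. The strength of $\mathcal P_i$ is $a_i+b_i$, and an instance is $M$-strong if all its priors have strength exactly $M$. For a probability vector $q$ on the arms let $\mu_q=\sum_i q_i\mu_i$; let $A^*$ be the best arm (the smallest index maximizing $\mu_j$), and let $\mathrm{ZEROS}_{j,N}$ be the event that the first $N$ samples of every arm $i<j$ are all $0$. Let $x_+=\max(x,0)$, $x_-=\max(-x,0)$. **Upper bound.** Fix absolute constants $C_{\rm TS},C_{\rm pad},C_{\rm UB}>0$ and put $$\varepsilon_{\rm TS}=\min_{i\ne j}\mathbb E[(\mu_i-\mu_j)_+],\quad \delta_{\rm TS}=\min_i\Pr[A^*=i],\quad N_{\rm TS}=C_{\rm TS}\,\varepsilon_{\rm TS}^{-2}\log\delta_{\rm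 TS}^{-1},$$ $$G_{\rm pad}=\min\{\mathbb E[(\mu_j-\mu_q)_+]: 2\le j\le K,\ q\text{ a distribution on the arms }i<j\},\quad N_{\rm pad}=C_{\rm pad}\,G_{\rm pad}^{-2}\log G_{\rm pad}^{-1},$$ $$N_{\rm boot}=\min\{N\in\mathbb N:\ \mathbb E[\mu_j-\mu_i\mid \mathrm{ZEROS}_{j,N}]>0\ \text{ for all arms } i<j\},\quad p_{\rm boot}=\min_j\Pr[\mathrm{ZEROS}_{j,N_{\rm boot}}].$$ The upper bound on the number of rounds for collecting $N$ samples of each arm is $$\mathrm{UB}(N)=C_{\rm UB}\,K\,\max(N,N_{\rm boot},N_{\rm pad})\;G_{\rm pad}^{-1}\,\log\!\big(G_{\rm pad}^{-1}p_{\rm boot}^{-1}\big).$$ **Lower bound.** $\mathrm{LB}=\max(K,N_{\rm boot},L)$, where $L=\max\ \mathbb E[(\mu_j-\mu_q)_-]\,/\,\mathbb E[(\mu_j-\mu_q)_+]$ over all arms $j$ and all probability vectors $q$ on the $K$ arms other than the point mass at $j$. **Corollary 5.6.** $M$ denotes a real number. (a) For all $C_{\rm TS},C_{\rm pad},C_{\rm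 UB}>0$ there is a constant $C>0$, depending only on them, such that for every $K\ge2$, every $M$ and every instance with all $a_i,b_i\ge1$ and all strengths at most $M$, $$\mathrm{UB}(N_{\rm TS})\le K^3\cdot\min(K,M)^{C M}.$$ (b) There is an absolute constant $c>0$ such that for all $K\ge2$ and $M\ge2$ some $M$-strong instance with $K$ arms and all $a_i,b_i\ge 1$ satisfies $\mathrm{LB}\ge\min(K,M)^{cM}$. (c) For every $\gamma>0$ there is $c>0$, depending only on $\gamma$, such that for every $K\ge2$ and $M$, every $M$-strong instance with $\mu_1^0-\mu_K^0\ge\gamma$ satisfies $\mathrm{LB}\ge2^{cM}$. More generally, $\mathrm{LB}\ge 2^{cM}$ for every instance having two arms $i\neq j$ of strength at least $M$ with $|\mu_i^0-\mu_j^0|\ge\gamma$. -/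

import Mathlib

open MeasureTheory ProbabilityTheory
open scoped ENNReal

noncomputable section

namespace IncentivizedExploration

/-! ### Bandit instances with independent priors

Throughout, `P i` is the prior of arm `i : Fin K` (a law on `[0,1]`), and the mean rewards
`μ : Fin K → ℝ` have the product law `Measure.pi P`. -/

/-- The prior mean reward of a prior. -/
def priorMean (p : Measure ℝ) : ℝ := ∫ x, x ∂p

/-- The mean reward `μ_q = ∑ i, q i * μ i` of a distribution `q` over arms. -/
def mix {K : ℕ} (q μ : Fin K → ℝ) : ℝ := ∑ i, q i * μ i

/-- Arm `i` is the best arm `A* = min (argmax_j μ_j)`: ties go to the smallest index. -/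
def IsBestArm {K : ℕ} (μ : Fin K → ℝ) (i : Fin K) : Prop :=
  (∀ j, μ j ≤ μ i) ∧ ∀ j, j < i → μ j < μ i

/-- Sample space: the vector of mean rewards, and one seed in `[0,1]` for every
(arm, index of the sample of this arm). -/
abbrev Outcome (K : ℕ) : Type := (Fin K → ℝ) × (Fin K × ℕ → unitInterval)

/-- The joint law: independent mean rewards with laws `P i`, and independent seeds, uniform on
`[0,1]` and independent of the mean rewards. -/
def model {K : ℕ} (P : Fin K → Measure ℝ) : Measure (Outcome K) :=
  (Measure.pi P).prod (Measure.infinitePi fun _ : Fin K × ℕ => (volume : Measure unitInterval))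

/-- The reward of the `s`-th sample of arm `i`: it is `1` if the seed is below `μ i`, and `0`
otherwise. Hence, given `μ`, the rewards are independent, and those of arm `i` are Bernoulli with
mean `μ i`. -/
def reward {K : ℕ} (ω : Outcome K) (i : Fin K) (s : ℕ) : ℕ :=
  if (ω.2 (i, s) : ℝ) < ω.1 i then 1 else 0

/-- The event `ZEROS_{j,N}`: the first `N` samples of each arm `i < j` return reward `0`. -/
def zeros {K : ℕ} (j : Fin K) (N : ℕ) : Set (Outcome K) :=
  {ω | ∀ i, i < j → ∀ s, s < N → reward ω i s = 0}

/-! ### Parameters of the upper bound -/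

/-- `ε_TS = min_{i ≠ j} E[(μ_i - μ_j)_+]`. -/
def epsTS {K : ℕ} (P : Fin K → Measure ℝ) : ℝ :=
  sInf {x | ∃ i j : Fin K, i ≠ j ∧ x = ∫ μ, max (μ i - μ j) 0 ∂(Measure.pi P)}

/-- `δ_TS = min_i Pr[A* = i]`. -/
def deltaTS {K : ℕ} (P : Fin K → Measure ℝ) : ℝ :=
  ⨅ i : Fin K, (Measure.pi P).real {μ | IsBestArm μ i}

/-- `N_TS = C_TS * ε_TS⁻² * log (1 / δ_TS)`, the number of samples of each arm that suffices to
warm-start Thompson sampling. -/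
def nTS {K : ℕ} (cTS : ℝ) (P : Fin K → Measure ℝ) : ℝ :=
  cTS * (epsTS P)⁻¹ ^ 2 * Real.log (deltaTS P)⁻¹

/-- `G_pad = min E[(μ_j - μ_q)_+]` over arms `j` and distributions `q` over the arms `i < j`
(for the first arm there is no such `q`). -/
def gPad {K : ℕ} (P : Fin K → Measure ℝ) : ℝ :=
  sInf {x | ∃ j : Fin K, ∃ q ∈ stdSimplex ℝ (Fin K), (∀ i, j ≤ i → q i = 0) ∧
    x = ∫ μ, max (μ j - mix q μ) 0 ∂(Measure.pi P)}

/-- `N_pad = C_pad * G_pad⁻² * log (1 / G_pad)`. -/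
def nPad {K : ℕ} (cPad : ℝ) (P : Fin K → Measure ℝ) : ℝ :=
  cPad * (gPad P)⁻¹ ^ 2 * Real.log (gPad P)⁻¹

/-- `N_boot`: the smallest `N` such that `E[μ_j - μ_i | ZEROS_{j,N}] > 0` for all arms `i < j`. -/
def nBoot {K : ℕ} (P : Fin K → Measure ℝ) : ℕ :=
  sInf {N | ∀ i j : Fin K, i < j →
    0 < ∫ ω, (ω.1 j - ω.1 i) ∂(ProbabilityTheory.cond (model P) (zeros j N))}

/-- `p_boot = min_j Pr[ZEROS_{j,N_boot}]`. -/
def pBoot {K : ℕ} (P : Fin K → Measure ℝ) : ℝ :=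
  ⨅ j : Fin K, (model P).real (zeros j (nBoot P))

/-- The upper bound on the number of rounds needed to collect `N` samples of each arm:
`UB(N) = C_UB * K * N * G_pad⁻¹ * log (G_pad⁻¹ * p_boot⁻¹)` for `N ≥ max (N_boot, N_pad)`, and
`UB(N) = UB(max (N_boot, N_pad))` for smaller `N`. -/
def roundsUB {K : ℕ} (cPad cUB : ℝ) (P : Fin K → Measure ℝ) (N : ℝ) : ℝ :=
  cUB * K * max N (max (nBoot P : ℝ) (nPad cPad P)) * (gPad P)⁻¹ *
    Real.log ((gPad P)⁻¹ * (pBoot P)⁻¹)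

/-! ### The lower bound -/

/-- `L = max E[(μ_j - μ_q)_-] / E[(μ_j - μ_q)_+]` over arms `j` and distributions `q` over all
arms, as an extended nonnegative real. The meaningless ratio `0 / 0`, for `q` concentrated on
arm `j`, counts as `0`. -/
def mainLB {K : ℕ} (P : Fin K → Measure ℝ) : ℝ≥0∞ :=
  ⨆ j : Fin K, ⨆ q ∈ stdSimplex ℝ (Fin K),
    (∫⁻ μ, ENNReal.ofReal (mix q μ - μ j) ∂(Measure.pi P)) /
      ∫⁻ μ, ENNReal.ofReal (μ j - mix q μ) ∂(Measure.pi P)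

/-- The lower bound `LB = max (K, N_boot, L)` on the number of rounds needed to sample each
arm at least once. -/
def roundsLB {K : ℕ} (P : Fin K → Measure ℝ) : ℝ≥0∞ :=
  max (K : ℝ≥0∞) (max (nBoot P : ℝ≥0∞) (mainLB P))

/-! ### Beta priors -/

/-- A problem instance with `K` arms and Beta priors `Beta (a i) (b i)`, the arms being ordered by
nonincreasing prior mean reward. -/
structure BetaInstance (K : ℕ) where
  a : Fin K → ℝ
  b : Fin K → ℝ
  a_pos : ∀ i, 0 < a i
  b_pos : ∀ i, 0 < b i
  sorted : Antitone fun i => priorMean (betaMeasure (a i) (b i))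

namespace BetaInstance

variable {K : ℕ}

/-- The priors of the instance. -/
def prior (I : BetaInstance K) (i : Fin K) : Measure ℝ := betaMeasure (I.a i) (I.b i)

/-- The prior mean reward of arm `i`. -/
def mean (I : BetaInstance K) (i : Fin K) : ℝ := priorMean (I.prior i)

/-- The strength of (the prior of) arm `i`. -/
def strength (I : BetaInstance K) (i : Fin K) : ℝ := I.a i + I.b i

/-- All parameters of the Beta priors are at least `1`. -/
def ParamsGeOne (I : BetaInstance K) : Prop := ∀ i, 1 ≤ I.a i ∧ 1 ≤ I.b i

/-- All arms have strength exactly `M`. -/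
def IsStrong (I : BetaInstance K) (M : ℝ) : Prop := ∀ i, I.strength i = M

end BetaInstance

end IncentivizedExploration

end

namespace IncentivizedExploration

/-! ### The Beta distribution -/

/-! Write `m = min K M`. The three parts rest on two-sided tail estimates for Beta laws.

Part (a): if both parameters are at least 1, the Beta function is at most 1, so the density is at
least `s ^ (a + b - 2)` on `[s, 1 - s]`, and an interval of length `t` at either end of `[0,1]` has
mass at least `(t / 2) ^ M` (`betaMeasure_anticoncentration`). Independence then gives `ε_TS ≥
8^(-2M) / 2` and `δ_TS ≥ 8^(-MK)`. For `G_pad` there are two competing bounds. All prior means are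
at most `1 - 1/M`, so averaging over the mixture while arm `j` exceeds `1 - 1/(2M)` gives roughly
`M^(-M)` (`le_integral_of_strength`). Alternatively, some arm has weight at least `1/K` in `q`, and
pushing that arm below `1/4` and arm `j` above `1 - 1/(2K)` gives roughly `K^(-M)` up to a factor
`8^(-M)` (`le_integral_of_card`). After `N` zeros the posterior mean is `a / (a + b + N)`, so
`N_boot ≤ M^2 + 1`, and `p_boot` is bounded below accordingly. Every parameter is thus polynomial in
`R = m ^ M`, apart from linear factors of `K` in `log δ_TS⁻¹` and `log p_boot⁻¹`; `roundsUB_arith`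
multiplies them out.

Parts (b) and (c): the numerator of `L` is at least the difference of the means, and the denominator
is at most `Pr[μ_q < μ_j]`, which a threshold splits into two one-sided tails
(`ofReal_div_le_mainLB`, `measureReal_mix_lt_le`).

In (c), `q` is a point mass, and Markov's inequality for a moment of order proportional to `M` makes
both tails exponentially small. In (b), many arms `Beta(M - 1, 1)` face one arm `Beta(1, M - 1)`,
and `q` is uniform on the former. With threshold `1 - 1/√m`, the bad arm exceeds it with probability
`m^(-Ω(M))`. The mixture falls below it with a comparable probability because the deviations of
about `K` arms multiply (`measureReal_mix_le`). For bounded `M`, the terms `K` in `LB` suffice. -/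

@[fun_prop]
theorem measurable_betaPDF (a b : ℝ) : Measurable (betaPDF a b) :=
  (measurable_betaPDFReal a b).ennreal_ofReal

theorem ae_betaMeasure_mem_Ioo (a b : ℝ) : ∀ᵐ x ∂betaMeasure a b, x ∈ Set.Ioo (0 : ℝ) 1 := by
  rw [betaMeasure, ae_withDensity_iff (measurable_betaPDF a b)]
  refine Filter.Eventually.of_forall fun x hx => ⟨?_, ?_⟩
  · by_contra h
    exact hx (betaPDF_eq_zero_of_nonpos (not_lt.1 h))
  · by_contra h
    exact hx (betaPDF_eq_zero_of_one_le (not_lt.1 h))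

/-- Tilting a Beta density by powers shifts its parameters. Negative real exponents are allowed on
purpose: moments such as `x ^ (-(a / 2))` drive the tail bounds for the hard instance. -/
theorem betaPDF_mul_rpow {a b u v : ℝ} (ha : 0 < a) (hb : 0 < b) (hu : 0 < a + u)
    (hv : 0 < b + v) (x : ℝ) :
    betaPDF a b x * ENNReal.ofReal (x ^ u * (1 - x) ^ v) =
      ENNReal.ofReal (beta (a + u) (b + v) / beta a b) * betaPDF (a + u) (b + v) x := by
  have h1 := beta_pos ha hb
  have h2 := beta_pos hu hv
  by_cases hx : 0 < x ∧ x < 1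
  · have hx' : 0 < 1 - x := by linarith [hx.2]
    rw [betaPDF_of_pos_lt_one hx.1 hx.2, betaPDF_of_pos_lt_one hx.1 hx.2,
      ← ENNReal.ofReal_mul, ← ENNReal.ofReal_mul (by positivity)]
    · congr 1
      rw [show a + u - 1 = (a - 1) + u by ring, show b + v - 1 = (b - 1) + v by ring,
        Real.rpow_add hx.1, Real.rpow_add hx']
      field_simp
    · have := Real.rpow_pos_of_pos hx.1 (a - 1)
      have := Real.rpow_pos_of_pos hx' (b - 1)
      positivity
  · simp [betaPDF_eq, hx]

theorem lintegral_rpow_betaMeasure {a b u v : ℝ} (ha : 0 < a) (hb : 0 < b) (hu : 0 < a + u)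
    (hv : 0 < b + v) :
    ∫⁻ x, ENNReal.ofReal (x ^ u * (1 - x) ^ v) ∂betaMeasure a b =
      ENNReal.ofReal (beta (a + u) (b + v) / beta a b) := by
  rw [betaMeasure, lintegral_withDensity_eq_lintegral_mul _ (measurable_betaPDF a b) (by fun_prop)]
  simp only [Pi.mul_apply, betaPDF_mul_rpow ha hb hu hv]
  rw [lintegral_const_mul _ (measurable_betaPDF _ _),
    lintegral_betaPDF_eq_one hu hv, mul_one]

theorem ae_rpow_nonneg_betaMeasure (a b u v : ℝ) :
    0 ≤ᵐ[betaMeasure a b] fun x => x ^ u * (1 - x) ^ v := by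
  filter_upwards [ae_betaMeasure_mem_Ioo a b] with x hx
  exact mul_nonneg (Real.rpow_nonneg hx.1.le _) (Real.rpow_nonneg (by linarith [hx.2]) _)

theorem integrable_rpow_betaMeasure {a b u v : ℝ} (ha : 0 < a) (hb : 0 < b) (hu : 0 < a + u)
    (hv : 0 < b + v) : Integrable (fun x => x ^ u * (1 - x) ^ v) (betaMeasure a b) := by
  refine ⟨Measurable.aestronglyMeasurable (by fun_prop), ?_⟩
  rw [hasFiniteIntegral_iff_ofReal (ae_rpow_nonneg_betaMeasure a b u v),
    lintegral_rpow_betaMeasure ha hb hu hv]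
  exact ENNReal.ofReal_lt_top

theorem integral_rpow_betaMeasure {a b u v : ℝ} (ha : 0 < a) (hb : 0 < b) (hu : 0 < a + u)
    (hv : 0 < b + v) :
    ∫ x, x ^ u * (1 - x) ^ v ∂betaMeasure a b = beta (a + u) (b + v) / beta a b := by
  rw [integral_eq_lintegral_of_nonneg_ae (ae_rpow_nonneg_betaMeasure a b u v)
    (Measurable.aestronglyMeasurable (by fun_prop)), lintegral_rpow_betaMeasure ha hb hu hv,
    ENNReal.toReal_ofReal (div_nonneg (beta_pos hu hv).le (beta_pos ha hb).le)]

theorem integral_pow_betaMeasure {a b : ℝ} (ha : 0 < a) (hb : 0 < b) (k l : ℕ) :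
    ∫ x, x ^ k * (1 - x) ^ l ∂betaMeasure a b = beta (a + k) (b + l) / beta a b := by
  rw [← integral_rpow_betaMeasure ha hb (by positivity) (by positivity)]
  simp only [Real.rpow_natCast]

theorem integrable_pow_betaMeasure {a b : ℝ} (ha : 0 < a) (hb : 0 < b) (k l : ℕ) :
    Integrable (fun x => x ^ k * (1 - x) ^ l) (betaMeasure a b) := by
  have := integrable_rpow_betaMeasure ha hb (u := k) (v := l) (by positivity) (by positivity)
  simpa only [Real.rpow_natCast] using this

theorem beta_comm (a b : ℝ) : beta a b = beta b a := by
  rw [beta, beta, mul_comm, add_comm]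

theorem beta_add_one_left {a b : ℝ} (ha : 0 < a) (hb : 0 < b) :
    beta (a + 1) b = a / (a + b) * beta a b := by
  have := (Real.Gamma_pos_of_pos (add_pos ha hb)).ne'
  rw [beta, beta, Real.Gamma_add_one ha.ne', show a + 1 + b = a + b + 1 by ring,
    Real.Gamma_add_one (add_pos ha hb).ne']
  field_simp

theorem priorMean_betaMeasure {a b : ℝ} (ha : 0 < a) (hb : 0 < b) :
    priorMean (betaMeasure a b) = a / (a + b) := by
  have h := integral_pow_betaMeasure ha hb 1 0
  simp only [pow_one, pow_zero, mul_one, Nat.cast_one, Nat.cast_zero, add_zero] at h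
  rw [priorMean, h, beta_add_one_left ha hb, mul_div_assoc, div_self (beta_pos ha hb).ne', mul_one]

/-- The `k`-th moment is the product of the ratios `(a + n) / (a + b + n)` over `n < k`; they
increase with `n`, so a bound at `n = k` controls them all. -/
theorem beta_add_nat_le {a b ρ : ℝ} (ha : 0 < a) (hb : 0 < b) (k : ℕ)
    (hρ : (a + k) / (a + b + k) ≤ ρ) :
    beta (a + k) b ≤ ρ ^ k * beta a b := by
  -- The hypothesis on `ρ` stays anchored at `k`, so the induction runs over `n ≤ k`.
  suffices H : ∀ n : ℕ, n ≤ k → beta (a + n) b ≤ ρ ^ n * beta a b from H k le_rfl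
  have hρ0 : 0 ≤ ρ := le_trans (by positivity) hρ
  intro n
  induction n with
  | zero => simp
  | succ n ih =>
    intro hn
    have hnk : ((n : ℝ)) ≤ k := by exact_mod_cast (by omega : n ≤ k)
    have h1 : (a + n) / (a + n + b) ≤ ρ := by
      refine le_trans ?_ hρ
      rw [div_le_div_iff₀ (by positivity) (by positivity)]
      nlinarith
    push_cast
    rw [← add_assoc, beta_add_one_left (by positivity) hb, pow_succ']
    calc _ ≤ ρ * (ρ ^ n * beta a b) :=
          mul_le_mul h1 (ih (by omega)) (beta_pos (by positivity) hb).le hρ0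
      _ = _ := by ring

/-- Concentration of a variable whose `k`-th moment is that of a Beta distribution. -/
theorem measureReal_ge_le_of_beta_moment {Ω : Type*} [MeasurableSpace Ω] {ν : Measure Ω}
    [IsFiniteMeasure ν] {f : Ω → ℝ} {a b γ : ℝ} (k : ℕ) (ha : 0 < a) (hb : 0 < b)
    (hγ : 0 < γ) (hγ1 : γ ≤ 1) (hk : (k : ℝ) ≤ γ / 2 * (a + b)) (hf : 0 ≤ᵐ[ν] f)
    (hi : Integrable (fun x => f x ^ k) ν)
    (hm : ∫ x, f x ^ k ∂ν = beta (a + k) b / beta a b) :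
    ν.real {x | a / (a + b) + γ ≤ f x} ≤ (1 - γ / 4) ^ k := by
  set p := a / (a + b) with hp
  have hp0 : 0 < p := by positivity
  have hp1 : p ≤ 1 := by rw [hp, div_le_one (by positivity)]; linarith
  have hpa : p * (a + b) = a := by rw [hp]; field_simp
  have hρ : (a + k) / (a + b + k) ≤ p + γ / 2 := by
    rw [div_le_iff₀ (by positivity)]
    have : 0 ≤ (p + γ / 2) * k := by positivity
    nlinarith
  have h1 : beta (a + k) b / beta a b ≤ (p + γ / 2) ^ k := by
    rw [div_le_iff₀ (beta_pos ha hb)]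
    exact beta_add_nat_le ha hb k hρ
  have h2 : (p + γ) ^ k * ν.real {x | (p + γ) ^ k ≤ f x ^ k} ≤ ∫ x, f x ^ k ∂ν :=
    mul_meas_ge_le_integral_of_nonneg (hf.mono fun x hx => pow_nonneg hx k) hi _
  have h3 : ν.real {x | p + γ ≤ f x} ≤ ν.real {x | (p + γ) ^ k ≤ f x ^ k} :=
    measureReal_mono fun x (hx : p + γ ≤ f x) => pow_le_pow_left₀ (by positivity) hx k
  -- Equivalent to `p + γ ≤ 2`.
  have h4 : p + γ / 2 ≤ (1 - γ / 4) * (p + γ) := by nlinarith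
  have h5 : (p + γ / 2) ^ k ≤ (1 - γ / 4) ^ k * (p + γ) ^ k := by
    rw [← mul_pow]
    exact pow_le_pow_left₀ (by positivity) h4 k
  have h6 : 0 < (p + γ) ^ k := by positivity
  nlinarith

theorem betaMeasure_upper_tail {a b γ : ℝ} (k : ℕ) (ha : 0 < a) (hb : 0 < b)
    (hγ : 0 < γ) (hγ1 : γ ≤ 1) (hk : (k : ℝ) ≤ γ / 2 * (a + b)) :
    (betaMeasure a b).real {x | a / (a + b) + γ ≤ x} ≤ (1 - γ / 4) ^ k := by
  have := isProbabilityMeasureBeta ha hb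
  refine measureReal_ge_le_of_beta_moment (f := fun x => x) k ha hb hγ hγ1 hk
    ((ae_betaMeasure_mem_Ioo a b).mono fun x hx => hx.1.le) ?_ ?_
  · simpa using integrable_pow_betaMeasure ha hb k 0
  · simpa using integral_pow_betaMeasure ha hb k 0

/-- The reflection `x ↦ 1 - x` exchanges the two parameters and reduces this to an upper tail. -/
theorem betaMeasure_lower_tail {a b γ : ℝ} (k : ℕ) (ha : 0 < a) (hb : 0 < b)
    (hγ : 0 < γ) (hγ1 : γ ≤ 1) (hk : (k : ℝ) ≤ γ / 2 * (a + b)) :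
    (betaMeasure a b).real {x | x ≤ a / (a + b) - γ} ≤ (1 - γ / 4) ^ k := by
  have := isProbabilityMeasureBeta ha hb
  have h := measureReal_ge_le_of_beta_moment (f := fun x => 1 - x) (ν := betaMeasure a b)
    k hb ha hγ hγ1 (by rwa [add_comm b a])
    ((ae_betaMeasure_mem_Ioo a b).mono fun x hx => by
      have := hx.2
      simp only [Pi.zero_apply]
      linarith) (by simpa using integrable_pow_betaMeasure ha hb 0 k)
    (by simpa [beta_comm _ a] using integral_pow_betaMeasure ha hb 0 k)
  refine le_trans (measureReal_mono fun x (hx : x ≤ _) => ?_) h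
  have : a / (a + b) + b / (b + a) = 1 := by rw [add_comm b a]; field_simp
  rw [Set.mem_ofPred_eq]
  linarith

/-- With nonnegative exponents the density is at most `1 / beta a b` on an interval of length 1, yet
it integrates to 1. -/
theorem beta_le_one {a b : ℝ} (ha : 1 ≤ a) (hb : 1 ≤ b) : beta a b ≤ 1 := by
  have hB := beta_pos (by linarith : 0 < a) (by linarith : 0 < b)
  have h := lintegral_betaPDF_eq_one (by linarith : 0 < a) (by linarith : 0 < b)
  have h2 : ∫⁻ x, betaPDF a b x ≤ ENNReal.ofReal (1 / beta a b) := by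
    rw [lintegral_betaPDF]
    calc _ ≤ ∫⁻ _ in Set.Ioo (0 : ℝ) 1, ENNReal.ofReal (1 / beta a b) := by
          refine setLIntegral_mono measurable_const fun x hx => ENNReal.ofReal_le_ofReal ?_
          have h1 : x ^ (a - 1) ≤ 1 := Real.rpow_le_one hx.1.le hx.2.le (by linarith)
          have h2 : (1 - x) ^ (b - 1) ≤ 1 :=
            Real.rpow_le_one (by linarith [hx.2]) (by linarith [hx.1]) (by linarith)
          have h3 : 0 ≤ x ^ (a - 1) := Real.rpow_nonneg hx.1.le _
          rw [mul_assoc]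
          refine mul_le_of_le_one_right (by positivity) (mul_le_one₀ h1 ?_ h2)
          exact Real.rpow_nonneg (by linarith [hx.2]) _
      _ = _ := by simp
  rw [h, ENNReal.one_le_ofReal, le_div_iff₀ hB] at h2
  linarith

theorem le_betaMeasure_Icc {a b l r s : ℝ} (ha : 1 ≤ a) (hb : 1 ≤ b) (hs : 0 < s) (hl : s ≤ l)
    (hr : r ≤ 1 - s) (hlr : l ≤ r) :
    s ^ (a + b - 2) * (r - l) ≤ (betaMeasure a b).real (Set.Icc l r) := by
  have hB := beta_pos (by linarith : 0 < a) (by linarith : 0 < b)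
  have := isProbabilityMeasureBeta (by linarith : 0 < a) (by linarith : 0 < b)
  rw [measureReal_def, ← ENNReal.ofReal_le_iff_le_toReal (measure_ne_top _ _), betaMeasure,
    withDensity_apply _ measurableSet_Icc]
  calc _ = ∫⁻ _ in Set.Icc l r, ENNReal.ofReal (s ^ (a + b - 2)) := by
        rw [setLIntegral_const, Real.volume_Icc, ENNReal.ofReal_mul (by positivity)]
    _ ≤ _ := by
        refine setLIntegral_mono (measurable_betaPDF a b) fun x hx => ?_
        have hx0 : 0 < x := by linarith [hx.1]
        have hx1 : 0 < 1 - x := by linarith [hx.2]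
        rw [betaPDF_of_pos_lt_one hx0 (by linarith)]
        refine ENNReal.ofReal_le_ofReal ?_
        rw [show a + b - 2 = (a - 1) + (b - 1) by ring, Real.rpow_add hs, mul_assoc]
        have h1 : s ^ (a - 1) ≤ x ^ (a - 1) :=
          Real.rpow_le_rpow hs.le (by linarith [hx.1]) (by linarith)
        have h2 : s ^ (b - 1) ≤ (1 - x) ^ (b - 1) :=
          Real.rpow_le_rpow hs.le (by linarith [hx.2]) (by linarith)
        have h3 : 1 ≤ 1 / beta a b := by rw [le_div_iff₀ hB]; linarith [beta_le_one ha hb]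
        calc _ ≤ x ^ (a - 1) * (1 - x) ^ (b - 1) := by gcongr
          _ ≤ _ := le_mul_of_one_le_left (by positivity) h3

theorem betaMeasure_anticoncentration {a b M t : ℝ} (ha : 1 ≤ a) (hb : 1 ≤ b) (hM : a + b ≤ M)
    (ht : 0 < t) (ht2 : t ≤ 1 / 2) :
    (t / 2) ^ M ≤ (betaMeasure a b).real (Set.Ici (1 - t)) ∧
      (t / 2) ^ M ≤ (betaMeasure a b).real (Set.Iic t) := by
  have := isProbabilityMeasureBeta (by linarith : 0 < a) (by linarith : 0 < b)
  -- Only the half of the end interval at distance at least `t / 2` from the endpoint is used: its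
  -- length is `t / 2` and the density there is at least `(t / 2) ^ (a + b - 2)`.
  have h : (t / 2) ^ M ≤ (t / 2) ^ (a + b - 2) * (t / 2) := by
    rw [← Real.rpow_add_one (by positivity)]
    exact Real.rpow_le_rpow_of_exponent_ge (by positivity) (by linarith) (by linarith)
  constructor
  · refine h.trans ?_
    have h1 := le_betaMeasure_Icc (s := t / 2) (l := 1 - t) (r := 1 - t / 2) ha hb
      (by positivity) (by linarith) le_rfl (by linarith)
    rw [show 1 - t / 2 - (1 - t) = t / 2 by ring] at h1
    exact h1.trans (measureReal_mono fun x hx => hx.1)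
  · refine h.trans ?_
    have h1 := le_betaMeasure_Icc (s := t / 2) (l := t / 2) (r := t) ha hb
      (by positivity) le_rfl (by linarith) (by linarith)
    rw [show t - t / 2 = t / 2 by ring] at h1
    exact h1.trans (measureReal_mono fun x hx => hx.2)

/-! ### Product priors on the unit cube -/

section Product

variable {K : ℕ} {P : Fin K → Measure ℝ} [∀ i, IsProbabilityMeasure (P i)]

theorem measureReal_pi_eval (i : Fin K) {S : Set ℝ} (hS : MeasurableSet S) :
    (Measure.pi P).real {μ | μ i ∈ S} = (P i).real S :=
  (measurePreserving_eval P i).measureReal_preimage hS.nullMeasurableSet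

theorem measurable_mix (q : Fin K → ℝ) : Measurable (mix q) := by
  unfold mix
  fun_prop

theorem integral_pi_eval (i : Fin K) : ∫ μ, μ i ∂(Measure.pi P) = priorMean (P i) :=
  integral_comp_eval (μ := P) (f := fun x : ℝ => x) measurable_id.aestronglyMeasurable

theorem measureReal_mix_lt_le (j : Fin K) (q : Fin K → ℝ) (t : ℝ) :
    (Measure.pi P).real {μ | mix q μ < μ j} ≤
      (Measure.pi P).real {μ | mix q μ ≤ t} + (P j).real (Set.Ici t) := by
  rw [← measureReal_pi_eval (P := P) j measurableSet_Ici]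
  refine (measureReal_mono fun μ (h : mix q μ < μ j) => ?_).trans (measureReal_union_le _ _)
  rcases le_total (mix q μ) t with h' | h'
  · exact Or.inl h'
  · exact Or.inr (h'.trans h.le)

variable (hP : ∀ i, ∀ᵐ x ∂P i, x ∈ Set.Ioo (0 : ℝ) 1)

include hP

theorem ae_pi_mem_Ioo : ∀ᵐ μ ∂(Measure.pi P), ∀ i, μ i ∈ Set.Ioo (0 : ℝ) 1 :=
  ae_all_iff.2 fun i => (measurePreserving_eval P i).quasiMeasurePreserving.ae (hP i)

theorem integrable_pi_eval (i : Fin K) : Integrable (fun μ => μ i) (Measure.pi P) := by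
  refine Integrable.of_bound (measurable_pi_apply i).aestronglyMeasurable 1 ?_
  filter_upwards [ae_pi_mem_Ioo hP] with μ h
  rw [Real.norm_eq_abs, abs_of_pos (h i).1]
  exact (h i).2.le

theorem integrable_mix (q : Fin K → ℝ) : Integrable (mix q) (Measure.pi P) := by
  unfold mix
  exact integrable_finsetSum _ fun i _ => (integrable_pi_eval hP i).const_mul _

theorem integral_mix (q : Fin K → ℝ) :
    ∫ μ, mix q μ ∂(Measure.pi P) = ∑ i, q i * priorMean (P i) := by
  unfold mix
  rw [integral_finsetSum _ fun i _ => (integrable_pi_eval hP i).const_mul _]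
  simp only [integral_const_mul, integral_pi_eval]

theorem ae_mix_mem_Icc {q : Fin K → ℝ} (hq : q ∈ stdSimplex ℝ (Fin K)) :
    ∀ᵐ μ ∂(Measure.pi P), mix q μ ∈ Set.Icc (0 : ℝ) 1 := by
  filter_upwards [ae_pi_mem_Ioo hP] with μ h
  refine ⟨Finset.sum_nonneg fun i _ => mul_nonneg (hq.1 i) (h i).1.le, ?_⟩
  calc mix q μ ≤ ∑ i, q i * 1 :=
        Finset.sum_le_sum fun i _ => mul_le_mul_of_nonneg_left (h i).2.le (hq.1 i)
    _ = 1 := by simpa using hq.2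

/-- A positive part dominates the variable itself, which bounds the numerator; almost surely `μ j -
mix q μ` is at most 1, so the denominator is at most the probability that it is positive. -/
theorem ofReal_div_le_mainLB (j : Fin K) {q : Fin K → ℝ} (hq : q ∈ stdSimplex ℝ (Fin K))
    {x y : ℝ} (hy : 0 < y) (hx : x ≤ ∫ μ, (mix q μ - μ j) ∂(Measure.pi P))
    (hle : (Measure.pi P).real {μ | mix q μ < μ j} ≤ y) :
    ENNReal.ofReal (x / y) ≤ mainLB P := by
  have hint : Integrable (fun μ => mix q μ - μ j) (Measure.pi P) :=
    (integrable_mix hP q).sub (integrable_pi_eval hP j)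
  have hms : MeasurableSet {μ : Fin K → ℝ | mix q μ < μ j} :=
    measurableSet_lt (measurable_mix q) (measurable_pi_apply j)
  have hnum : ENNReal.ofReal x ≤ ∫⁻ μ, ENNReal.ofReal (mix q μ - μ j) ∂(Measure.pi P) := by
    refine (ENNReal.ofReal_le_ofReal (hx.trans (integral_mono hint hint.pos_part
      fun μ => le_max_left _ 0))).trans_eq ?_
    rw [ofReal_integral_eq_lintegral_ofReal hint.pos_part
      (Filter.Eventually.of_forall fun μ => le_max_right _ _)]
    exact lintegral_congr fun μ => by rw [ENNReal.ofReal_max]; simp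
  have hden : ∫⁻ μ, ENNReal.ofReal (μ j - mix q μ) ∂(Measure.pi P) ≤ ENNReal.ofReal y := by
    calc _ ≤ ∫⁻ μ, {μ : Fin K → ℝ | mix q μ < μ j}.indicator 1 μ ∂(Measure.pi P) := by
          refine lintegral_mono_ae ?_
          filter_upwards [ae_pi_mem_Ioo hP, ae_mix_mem_Icc hP hq] with μ h1 h2
          by_cases h : mix q μ < μ j
          · rw [Set.indicator_of_mem (by exact h), Pi.one_apply, ENNReal.ofReal_le_one]
            linarith [(h1 j).2, h2.1]
          · rw [ENNReal.ofReal_of_nonpos (by linarith)]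
            exact zero_le
      _ = ENNReal.ofReal ((Measure.pi P).real {μ | mix q μ < μ j}) := by
          rw [lintegral_indicator_one hms, ofReal_measureReal]
      _ ≤ _ := ENNReal.ofReal_le_ofReal hle
  rw [ENNReal.ofReal_div_of_pos hy]
  refine (ENNReal.div_le_div hnum hden).trans ?_
  exact le_iSup_of_le j (le_iSup₂_of_le q hq le_rfl)

/-- A Chernoff bound for mixtures of independent variables in `(0,1)`, by the
weighted inequality of arithmetic and geometric means. -/
theorem measureReal_mix_le {q : Fin K → ℝ} (hq : q ∈ stdSimplex ℝ (Fin K)) {s T : ℝ}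
    (hs : s < 1) (hT : 0 ≤ T) (hi : ∀ i, Integrable (fun x => x ^ (-(T * q i))) (P i)) :
    (Measure.pi P).real {μ | mix q μ ≤ 1 - s} ≤
      (1 - s) ^ T * ∏ i, ∫ x, x ^ (-(T * q i)) ∂(P i) := by
  have h1s : 0 < 1 - s := by linarith
  rw [← integral_fintype_prod_eq_prod (μ := P) (fun i x => x ^ (-(T * q i)))]
  have hF : 0 ≤ᵐ[Measure.pi P] fun μ => ∏ i, μ i ^ (-(T * q i)) := by
    filter_upwards [ae_pi_mem_Ioo hP] with μ h
    exact Finset.prod_nonneg fun i _ => Real.rpow_nonneg (h i).1.le _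
  have h := mul_meas_ge_le_integral_of_nonneg hF
    (Integrable.fintype_prod_dep (f := fun i x => x ^ (-(T * q i))) hi) ((1 - s) ^ (-T))
  have h2 : (Measure.pi P).real {μ | mix q μ ≤ 1 - s} ≤
      (Measure.pi P).real {μ | (1 - s) ^ (-T) ≤ ∏ i, μ i ^ (-(T * q i))} := by
    rw [measureReal_def, measureReal_def]
    refine ENNReal.toReal_mono (measure_ne_top _ _) (measure_mono_ae ?_)
    filter_upwards [ae_pi_mem_Ioo hP] with μ h h3
    have hpos : ∀ i, 0 < μ i := fun i => (h i).1
    have h4 : ∏ i, μ i ^ q i ≤ 1 - s :=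
      (Real.geom_mean_le_arith_mean_weighted Finset.univ q μ (fun i _ => hq.1 i) hq.2
        fun i _ => (hpos i).le).trans h3
    have h5 : 0 < ∏ i, μ i ^ q i := Finset.prod_pos fun i _ => Real.rpow_pos_of_pos (hpos i) _
    calc (1 - s) ^ (-T) ≤ (∏ i, μ i ^ q i) ^ (-T) :=
          Real.rpow_le_rpow_of_nonpos h5 h4 (by linarith)
      _ = ∏ i, μ i ^ (-(T * q i)) := by
          rw [← Real.finsetProd_rpow _ _ fun i _ => Real.rpow_nonneg (hpos i).le _]
          refine Finset.prod_congr rfl fun i _ => ?_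
          rw [← Real.rpow_mul (hpos i).le]
          congr 1
          ring
  have h6 : (1 - s) ^ T * (1 - s) ^ (-T) = 1 := by rw [← Real.rpow_add h1s]; simp
  have h7 : 0 < (1 - s) ^ T := Real.rpow_pos_of_pos h1s _
  calc _ = (1 - s) ^ T * ((1 - s) ^ (-T) * (Measure.pi P).real {μ | mix q μ ≤ 1 - s}) := by
        rw [← mul_assoc, h6, one_mul]
    _ ≤ _ := mul_le_mul_of_nonneg_left ((mul_le_mul_of_nonneg_left h2 (by positivity)).trans h)
        h7.le

end Product

/-! ### The lower bound for Beta instances -/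

namespace BetaInstance

variable {K : ℕ} (I : BetaInstance K)

instance (i : Fin K) : IsProbabilityMeasure (I.prior i) :=
  isProbabilityMeasureBeta (I.a_pos i) (I.b_pos i)

theorem ae_prior (i : Fin K) : ∀ᵐ x ∂I.prior i, x ∈ Set.Ioo (0 : ℝ) 1 :=
  ae_betaMeasure_mem_Ioo _ _

theorem mean_eq (i : Fin K) : I.mean i = I.a i / (I.a i + I.b i) :=
  priorMean_betaMeasure (I.a_pos i) (I.b_pos i)

theorem mean_pos (i : Fin K) : 0 < I.mean i := by
  have := I.a_pos i
  have := I.b_pos i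
  rw [mean_eq]
  positivity

theorem mean_lt_one (i : Fin K) : I.mean i < 1 := by
  have := I.a_pos i
  have := I.b_pos i
  rw [mean_eq, div_lt_one (by positivity)]
  linarith

theorem natCast_le_roundsLB {P : Fin K → Measure ℝ} : (K : ℝ≥0∞) ≤ roundsLB P := le_max_left _ _

theorem mainLB_le_roundsLB {P : Fin K → Measure ℝ} : mainLB P ≤ roundsLB P :=
  (le_max_right _ _).trans (le_max_right _ _)

theorem mix_single (i : Fin K) (μ : Fin K → ℝ) : mix (Pi.single i 1) μ = μ i := by
  simp [mix, Pi.single_apply]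

/-- Two arms with a gap in the prior mean rewards. -/
theorem le_mainLB_of_gap {γ : ℝ} (hγ : 0 < γ) {i j : Fin K}
    (hgap : γ ≤ I.mean i - I.mean j) (k : ℕ) (hi : (k : ℝ) ≤ γ / 4 * I.strength i)
    (hj : (k : ℝ) ≤ γ / 4 * I.strength j) :
    ENNReal.ofReal (γ / (2 * (1 - γ / 8) ^ k)) ≤ mainLB I.prior := by
  have hγ1 : γ ≤ 1 := by linarith [I.mean_lt_one i, I.mean_pos j]
  have h8 : 0 < 1 - γ / 8 := by linarith
  refine ofReal_div_le_mainLB I.ae_prior j (single_mem_stdSimplex ℝ i) (by positivity) ?_ ?_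
  · simp only [mix_single]
    rw [integral_sub (integrable_pi_eval I.ae_prior i) (integrable_pi_eval I.ae_prior j),
      integral_pi_eval, integral_pi_eval]
    exact hgap
  · refine (measureReal_mix_lt_le j _ (I.mean i - γ / 2)).trans ?_
    simp only [mix_single]
    have h1 := betaMeasure_lower_tail (γ := γ / 2) k (I.a_pos i) (I.b_pos i) (by positivity)
      (by linarith) (hi.trans_eq (by rw [strength]; ring))
    have h2 := betaMeasure_upper_tail (γ := γ / 2) k (I.a_pos j) (I.b_pos j) (by positivity)
      (by linarith) (hj.trans_eq (by rw [strength]; ring))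
    rw [← mean_eq] at h1 h2
    have h3 : (Measure.pi I.prior).real {μ | μ i ≤ I.mean i - γ / 2} =
      (I.prior i).real (Set.Iic (I.mean i - γ / 2)) := measureReal_pi_eval i measurableSet_Iic
    have h4 : (I.prior j).real (Set.Ici (I.mean i - γ / 2)) ≤
        (I.prior j).real {x | I.mean j + γ / 2 ≤ x} :=
      measureReal_mono fun x (hx : _ ≤ x) => by
        rw [Set.mem_ofPred_eq]
        linarith
    rw [h3]
    have h5 : (1 - γ / 2 / 4) ^ k = (1 - γ / 8) ^ k := by congr 1; ring
    rw [h5] at h1 h2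
    have h6 : (I.prior i).real (Set.Iic (I.mean i - γ / 2)) ≤ (1 - γ / 8) ^ k := h1
    have h7 := h4.trans h2
    linarith

/-- The logarithm of the second term is at least `A * M - B`, with `A`, `B` as set in the proof; the
`γ / 8` in `B` pays for rounding `k` down. The exponent rate `A / (2 * (B + 1))` is chosen so that 2
suffices until `A * M` is large enough to absorb `B`. -/
theorem two_rpow_le_max {γ : ℝ} (hγ : 0 < γ) (hγ1 : γ ≤ 1) {M : ℝ} (hM : 0 ≤ M) :
    (2 : ℝ) ^ (γ ^ 2 / 32 / (2 * (|Real.log (2 / γ)| + γ / 8 + 1)) * M) ≤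
      max 2 (γ / (2 * (1 - γ / 8) ^ ⌊γ / 4 * M⌋₊)) := by
  set B := |Real.log (2 / γ)| + γ / 8 with hB
  set A := γ ^ 2 / 32 with hA
  set k := ⌊γ / 4 * M⌋₊ with hk
  have hB0 : 0 ≤ B := by positivity
  have hA0 : 0 < A := by positivity
  rcases le_total (A * M) (2 * (B + 1)) with h | h
  · refine le_max_of_le_left ?_
    calc (2 : ℝ) ^ (A / (2 * (B + 1)) * M) ≤ 2 ^ (1 : ℝ) := by
          refine Real.rpow_le_rpow_of_exponent_le (by norm_num) ?_
          rw [div_mul_eq_mul_div, div_le_one (by positivity)]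
          exact h
      _ = 2 := Real.rpow_one 2
  · refine le_max_of_le_right ?_
    have hc : A / (2 * (B + 1)) * M ≤ A * M / 2 := by
      rw [div_mul_eq_mul_div]
      exact div_le_div_of_nonneg_left (by positivity) (by norm_num) (by linarith)
    have hc0 : 0 ≤ A / (2 * (B + 1)) * M := by positivity
    have hlog2 : Real.log 2 ≤ 1 := by linarith [Real.log_two_lt_d9]
    have hkM : γ / 4 * M < k + 1 := Nat.lt_floor_add_one _
    have h8 : 0 < 1 - γ / 8 := by linarith
    rw [← Real.log_le_log_iff (by positivity) (by positivity), Real.log_rpow (by norm_num),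
      Real.log_div hγ.ne' (by positivity), Real.log_mul (by norm_num) (by positivity),
      Real.log_pow]
    have h1 : Real.log (1 - γ / 8) ≤ -(γ / 8) := by
      linarith [Real.log_le_sub_one_of_pos h8]
    have h2 : (k : ℝ) * Real.log (1 - γ / 8) ≤ k * -(γ / 8) :=
      mul_le_mul_of_nonneg_left h1 (Nat.cast_nonneg k)
    have h3 : Real.log (2 / γ) = Real.log 2 - Real.log γ :=
      Real.log_div (by norm_num) hγ.ne'
    have h4 : γ / 8 * (γ / 4 * M) ≤ γ / 8 * (k + 1) :=
      mul_le_mul_of_nonneg_left hkM.le (by positivity)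
    have h5 : γ / 8 * (γ / 4 * M) = A * M := by rw [hA]; ring
    have h6 : A / (2 * (B + 1)) * M * Real.log 2 ≤ A / (2 * (B + 1)) * M * 1 :=
      mul_le_mul_of_nonneg_left hlog2 hc0
    have h7 := le_abs_self (Real.log (2 / γ))
    linarith

theorem two_rpow_le_roundsLB {γ : ℝ} (hγ : 0 < γ) {M : ℝ} {i j : Fin K} (hij : i ≠ j)
    (hi : M ≤ I.strength i) (hj : M ≤ I.strength j) (hgap : γ ≤ |I.mean i - I.mean j|) :
    ENNReal.ofReal ((2 : ℝ) ^ (γ ^ 2 / 32 / (2 * (|Real.log (2 / γ)| + γ / 8 + 1)) * M)) ≤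
      roundsLB I.prior := by
  wlog hm : I.mean j ≤ I.mean i generalizing i j
  · exact this hij.symm hj hi (by rwa [abs_sub_comm]) (not_le.1 hm).le
  rw [abs_of_nonneg (by linarith)] at hgap
  have hγ1 : γ ≤ 1 := by linarith [I.mean_lt_one i, I.mean_pos j]
  have hK : (2 : ℝ≥0∞) ≤ roundsLB I.prior := by
    refine le_trans ?_ natCast_le_roundsLB
    have : 2 ≤ K := by
      have := i.2
      have := j.2
      have : i.1 ≠ j.1 := fun h => hij (Fin.ext h)
      omega
    exact_mod_cast this
  rcases le_total 0 M with hM | hM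
  · refine (ENNReal.ofReal_le_ofReal (two_rpow_le_max hγ hγ1 hM)).trans ?_
    rw [ENNReal.ofReal_max]
    refine max_le (by simpa using hK) (le_trans ?_ mainLB_le_roundsLB)
    have hf : (⌊γ / 4 * M⌋₊ : ℝ) ≤ γ / 4 * M := Nat.floor_le (by positivity)
    exact I.le_mainLB_of_gap hγ hgap _ (hf.trans (by gcongr)) (hf.trans (by gcongr))
  · refine le_trans ?_ hK
    rw [← ENNReal.ofReal_ofNat 2]
    refine ENNReal.ofReal_le_ofReal ?_
    have hc : 0 ≤ γ ^ 2 / 32 / (2 * (|Real.log (2 / γ)| + γ / 8 + 1)) := by positivity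
    -- A nonpositive `M` is not excluded; then the power is at most 1.
    exact (Real.rpow_le_one_of_one_le_of_nonpos (by norm_num)
      (mul_nonpos_of_nonneg_of_nonpos hc hM)).trans (by norm_num)

end BetaInstance

/-! ### A hard instance: many good arms and a bad one -/

theorem beta_one_right {a : ℝ} (ha : 0 < a) : beta a 1 = a⁻¹ := by
  have := (Real.Gamma_pos_of_pos ha).ne'
  rw [beta, Real.Gamma_one, Real.Gamma_add_one ha.ne']
  field_simp

theorem integrable_rpow_neg_half_betaMeasure {a : ℝ} (ha : 0 < a) :
    Integrable (fun x => x ^ (-(a / 2))) (betaMeasure a 1) := by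
  simpa using integrable_rpow_betaMeasure (u := -(a / 2)) (v := 0) ha one_pos (by linarith)
    (by norm_num)

/-- The exponent is half the critical one `-a`, at which the moment diverges; this keeps the moment
equal to the constant 2 for every `a`. -/
theorem integral_rpow_neg_half_betaMeasure {a : ℝ} (ha : 0 < a) :
    ∫ x, x ^ (-(a / 2)) ∂betaMeasure a 1 = 2 := by
  have h := integral_rpow_betaMeasure (u := -(a / 2)) (v := 0) ha one_pos (by linarith)
    (by norm_num)
  simp only [Real.rpow_zero, mul_one, add_zero] at h
  rw [h, beta_one_right ha, beta_one_right (by linarith)]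
  field_simp
  ring

/-- Markov's inequality for `(1 - x) ^ (-(b / 2))`, whose mean is 2. -/
theorem betaMeasure_one_left_Ici_le {b s : ℝ} (hb : 0 < b) (hs : 0 < s) :
    (betaMeasure 1 b).real (Set.Ici (1 - s)) ≤ 2 * s ^ (b / 2) := by
  have := isProbabilityMeasureBeta one_pos hb
  have hi := integrable_rpow_betaMeasure (u := 0) (v := -(b / 2)) one_pos hb (by norm_num)
    (by linarith)
  have hm := integral_rpow_betaMeasure (u := 0) (v := -(b / 2)) one_pos hb (by norm_num)
    (by linarith)
  rw [add_zero, beta_comm, beta_comm 1, beta_one_right hb, beta_one_right (by linarith)] at hm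
  have h := mul_meas_ge_le_integral_of_nonneg (ae_rpow_nonneg_betaMeasure 1 b 0 (-(b / 2))) hi
    (s ^ (-(b / 2)))
  rw [hm, show (b + -(b / 2))⁻¹ / b⁻¹ = 2 by field_simp; ring] at h
  have h2 : (betaMeasure 1 b).real (Set.Ici (1 - s)) ≤
      (betaMeasure 1 b).real {x | s ^ (-(b / 2)) ≤ x ^ (0 : ℝ) * (1 - x) ^ (-(b / 2))} := by
    rw [measureReal_def, measureReal_def]
    refine ENNReal.toReal_mono (measure_ne_top _ _) (measure_mono_ae ?_)
    filter_upwards [ae_betaMeasure_mem_Ioo 1 b] with x hx hx2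
    have hx3 : 1 - s ≤ x := hx2
    have : s ^ (-(b / 2)) ≤ x ^ (0 : ℝ) * (1 - x) ^ (-(b / 2)) := by
      rw [Real.rpow_zero, one_mul]
      exact Real.rpow_le_rpow_of_nonpos (by linarith [hx.2]) (by linarith) (by linarith)
    exact this
  have h3 : s ^ (b / 2) * s ^ (-(b / 2)) = 1 := by rw [← Real.rpow_add hs]; simp
  calc _ = s ^ (b / 2) * (s ^ (-(b / 2)) * (betaMeasure 1 b).real (Set.Ici (1 - s))) := by
        rw [← mul_assoc, h3, one_mul]
    _ ≤ s ^ (b / 2) * 2 := by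
        have := Real.rpow_pos_of_pos hs (-(b / 2))
        have := Real.rpow_pos_of_pos hs (b / 2)
        gcongr
        exact (mul_le_mul_of_nonneg_left h2 (by positivity)).trans h
    _ = _ := mul_comm _ _

/-- All arms but the last have prior `Beta(M - 1, 1)`; the last has prior `Beta(1, M - 1)`. -/
def hardInstance (n : ℕ) {M : ℝ} (hM : 2 ≤ M) : BetaInstance (n + 1) where
  a i := if i = Fin.last n then 1 else M - 1
  b i := if i = Fin.last n then M - 1 else 1
  a_pos i := by split_ifs <;> linarith
  b_pos i := by split_ifs <;> linarith
  sorted := by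
    intro i j hij
    have hM0 : 0 < M - 1 := by linarith
    dsimp only
    by_cases hi : i = Fin.last n
    · have hj : j = Fin.last n := Fin.last_le_iff.1 (hi ▸ hij)
      rw [hi, hj]
    · by_cases hj : j = Fin.last n
      · simp only [hi, hj, if_true, if_false]
        rw [priorMean_betaMeasure one_pos hM0, priorMean_betaMeasure hM0 one_pos,
          div_le_div_iff₀ (by linarith) (by linarith)]
        nlinarith
      · simp only [hi, hj, if_false]
        exact le_rfl

namespace hardInstance

variable {n : ℕ} {M : ℝ} (hM : 2 ≤ M)

theorem paramsGeOne : (hardInstance n hM).ParamsGeOne := by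
  intro i
  simp only [hardInstance]
  constructor <;> split_ifs <;> linarith

theorem isStrong : (hardInstance n hM).IsStrong M := by
  intro i
  simp only [hardInstance, BetaInstance.strength]
  split_ifs <;> ring

theorem prior_last : (hardInstance n hM).prior (Fin.last n) = betaMeasure 1 (M - 1) := by
  simp [hardInstance, BetaInstance.prior]

theorem prior_of_ne {i : Fin (n + 1)} (hi : i ≠ Fin.last n) :
    (hardInstance n hM).prior i = betaMeasure (M - 1) 1 := by
  simp [hardInstance, BetaInstance.prior, hi]

end hardInstance

/-- The uniform distribution over all arms but the last. -/
noncomputable def uniformInit (n : ℕ) (i : Fin (n + 1)) : ℝ := if i = Fin.last n then 0 else (n : ℝ)⁻¹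

theorem sum_uniformInit_mul (n : ℕ) (f : Fin (n + 1) → ℝ) (x : ℝ)
    (hf : ∀ i, i ≠ Fin.last n → f i = x) (hn : n ≠ 0) :
    ∑ i, uniformInit n i * f i = x := by
  have hn' : (n : ℝ) ≠ 0 := Nat.cast_ne_zero.2 hn
  rw [Fin.sum_univ_castSucc]
  have : ∀ i : Fin n, uniformInit n i.castSucc * f i.castSucc = (n : ℝ)⁻¹ * x := fun i => by
    rw [hf _ (Fin.castSucc_lt_last i).ne, uniformInit, if_neg (Fin.castSucc_lt_last i).ne]
  rw [Finset.sum_congr rfl fun i _ => this i]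
  simp [uniformInit, hn']

theorem uniformInit_mem_stdSimplex {n : ℕ} (hn : n ≠ 0) :
    uniformInit n ∈ stdSimplex ℝ (Fin (n + 1)) := by
  refine ⟨fun i => ?_, ?_⟩
  · unfold uniformInit
    split_ifs
    · exact le_rfl
    · positivity
  · simpa using sum_uniformInit_mul n (fun _ => 1) 1 (fun _ _ => rfl) hn

/-- The choice `T = n * ((M - 1) / 2)` in `measureReal_mix_le` makes the exponent of each good arm
half critical, so each contributes a factor 2; the last arm has weight 0 and contributes 1. -/
theorem measureReal_hardInstance_mix_le {n : ℕ} (hn : n ≠ 0) {M : ℝ} (hM : 2 ≤ M) {s : ℝ}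
    (hs : s < 1) :
    (Measure.pi (hardInstance n hM).prior).real {μ | mix (uniformInit n) μ ≤ 1 - s} ≤
      (2 * (1 - s) ^ ((M - 1) / 2)) ^ n := by
  have hn' : (n : ℝ) ≠ 0 := Nat.cast_ne_zero.2 hn
  have hM1 : 0 < M - 1 := by linarith
  have hlast : -(n * ((M - 1) / 2) * uniformInit n (Fin.last n)) = 0 := by simp [uniformInit]
  have hne : ∀ i, i ≠ Fin.last n →
      -(n * ((M - 1) / 2) * uniformInit n i) = -((M - 1) / 2) := fun i hi => by
    rw [uniformInit, if_neg hi]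
    field_simp
  have h := measureReal_mix_le (hardInstance n hM).ae_prior (uniformInit_mem_stdSimplex hn) hs
    (T := n * ((M - 1) / 2)) (by positivity) fun i => by
      by_cases hi : i = Fin.last n
      · subst hi
        rw [hlast]
        simp
      · rw [hne i hi, hardInstance.prior_of_ne hM hi]
        exact integrable_rpow_neg_half_betaMeasure hM1
  refine h.trans_eq ?_
  have hl : ∀ i : Fin n, ∫ x, x ^ (-(n * ((M - 1) / 2) * uniformInit n i.castSucc))
      ∂(hardInstance n hM).prior i.castSucc = 2 := fun i => by
    have hi := (Fin.castSucc_lt_last i).ne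
    rw [hne _ hi, hardInstance.prior_of_ne hM hi]
    exact integral_rpow_neg_half_betaMeasure hM1
  rw [Fin.prod_univ_castSucc, Finset.prod_congr rfl fun i _ => hl i, hlast]
  simp only [Real.rpow_zero, integral_const, probReal_univ, smul_eq_mul, mul_one,
    Finset.prod_const, Finset.card_univ, Fintype.card_fin]
  rw [mul_pow, mul_comm (n : ℝ), Real.rpow_mul_natCast (by linarith), mul_comm]

theorem integral_hardInstance {n : ℕ} (hn : n ≠ 0) {M : ℝ} (hM : 2 ≤ M) :
    ∫ μ, (mix (uniformInit n) μ - μ (Fin.last n)) ∂(Measure.pi (hardInstance n hM).prior) =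
      1 - 2 / M := by
  set I := hardInstance n hM with hI
  have hM1 : 0 < M - 1 := by linarith
  rw [integral_sub (integrable_mix I.ae_prior _) (integrable_pi_eval I.ae_prior _),
    integral_mix I.ae_prior, integral_pi_eval, hI, hardInstance.prior_last,
    sum_uniformInit_mul n _ ((M - 1) / M) (fun i hi => ?_) hn, priorMean_betaMeasure one_pos hM1]
  · have : M ≠ 0 := by linarith
    rw [show 1 + (M - 1) = M by ring]
    field_simp
    ring
  · rw [hardInstance.prior_of_ne hM hi, priorMean_betaMeasure hM1 one_pos, sub_add_cancel]

/-- The deviation `s = 1 / √m` balances two demands: `s ^ M` must be a power `m ^ (-Ω(M))`, which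
handles the bad arm, while `n * s`, of order at least `√m`, must dominate `log m`, which handles the
mixture. -/
theorem hardInstance_failure_le {n : ℕ} {M m : ℝ} (hM : 64 ≤ M) (hm : 2 ≤ m)
    (hmM : m ≤ M) (hmn : m ≤ n + 1) :
    (2 * (1 - (√m)⁻¹) ^ ((M - 1) / 2)) ^ n + 2 * (√m)⁻¹ ^ ((M - 1) / 2) ≤
      3 * m ^ (-(M / 32)) := by
  set r := √m with hr
  have hr2 : r ^ 2 = m := Real.sq_sqrt (by linarith)
  have hr1 : 1 < r := by rw [hr, Real.lt_sqrt (by norm_num)]; linarith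
  have hr0 : 0 < r := by linarith
  have hlogm : Real.log m = 2 * Real.log r := by rw [← hr2, Real.log_pow]; norm_num
  have hlogr0 : 0 < Real.log r := Real.log_pos hr1
  have hlogr : Real.log r ≤ r := by linarith [Real.log_le_sub_one_of_pos hr0]
  have hs1 : 0 < 1 - r⁻¹ := by linarith [inv_lt_one_of_one_lt₀ hr1]
  set k := (M - 1) / 2 with hk
  have hkM : M / 4 ≤ k := by rw [hk]; linarith
  have hsM : 8 * r ≤ M := by
    have h8 : 8 ≤ √M := by rw [Real.le_sqrt (by norm_num) (by linarith)]; linarith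
    have hle : r ≤ √M := Real.sqrt_le_sqrt hmM
    nlinarith [Real.sq_sqrt (by linarith : 0 ≤ M)]
  have hn : r ^ 2 / 2 ≤ n := by
    have : (1 : ℝ) ≤ n := by linarith
    linarith
  -- The factor 2 from each Markov moment is absorbed by half of the exponent. This needs `8 * √m ≤
  -- M`, hence `m ≤ M` and `64 ≤ M`.
  have h2 : 2 * (1 - r⁻¹) ^ k ≤ Real.exp (-(M / (8 * r))) := by
    have hl2 : Real.log 2 ≤ 1 := by linarith [Real.log_two_lt_d9]
    rw [← Real.log_le_iff_le_exp (by positivity), Real.log_mul (by norm_num) (by positivity),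
      Real.log_rpow hs1]
    have h3 : k * Real.log (1 - r⁻¹) ≤ k * -r⁻¹ :=
      mul_le_mul_of_nonneg_left (by linarith [Real.log_le_sub_one_of_pos hs1]) (by linarith)
    have h4 : M / 4 * r⁻¹ ≤ k * r⁻¹ := by gcongr
    have h5 : M / 4 * r⁻¹ = 2 * (M / (8 * r)) := by field_simp; norm_num
    have h6 : 1 ≤ M / (8 * r) := by rw [le_div_iff₀ (by positivity)]; linarith
    linarith
  have hA : (2 * (1 - r⁻¹) ^ k) ^ n ≤ m ^ (-(M / 32)) := by
    calc _ ≤ Real.exp (-(M / (8 * r))) ^ n := pow_le_pow_left₀ (by positivity) h2 n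
      _ = Real.exp (n * -(M / (8 * r))) := (Real.exp_nat_mul _ _).symm
      _ ≤ Real.exp (Real.log m * (-(M / 32))) := by
          rw [Real.exp_le_exp, hlogm]
          have h3 : r ^ 2 / 2 * (M / (8 * r)) ≤ n * (M / (8 * r)) :=
            mul_le_mul_of_nonneg_right hn (div_nonneg (by linarith) (by linarith))
          have h4 : r ^ 2 / 2 * (M / (8 * r)) = M / 16 * r := by field_simp; norm_num
          have h5 : M / 16 * Real.log r ≤ M / 16 * r :=
            mul_le_mul_of_nonneg_left hlogr (by linarith)
          linarith
      _ = _ := (Real.rpow_def_of_pos (by linarith) _).symm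
  have hB : r⁻¹ ^ k ≤ m ^ (-(M / 32)) := by
    rw [Real.rpow_def_of_pos (by positivity), Real.rpow_def_of_pos (by linarith),
      Real.exp_le_exp, hlogm, Real.log_inv]
    nlinarith
  linarith

theorem rpow_le_roundsLB_hardInstance {n : ℕ} (hn : n ≠ 0) {M : ℝ} (hM : 2 ≤ M) :
    ENNReal.ofReal ((min ((n + 1 : ℕ) : ℝ) M) ^ (1 / 192 * M)) ≤
      roundsLB (hardInstance n hM).prior := by
  set m := min ((n + 1 : ℕ) : ℝ) M with hm
  have hn1 : (1 : ℝ) ≤ n := by exact_mod_cast Nat.one_le_iff_ne_zero.2 hn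
  have hmn : m ≤ n + 1 := (min_le_left _ _).trans_eq (by push_cast; rfl)
  have hmM : m ≤ M := min_le_right _ _
  have hm2 : 2 ≤ m := le_min (by push_cast; linarith) hM
  -- Up to 192 the exponent is at most 1 and the term `K` of `LB` suffices. Beyond it, `m ^ (M / 64)
  -- ≥ 2 ^ 3` absorbs the constant `6 = 3 / (1 / 2)`.
  rcases le_total M 192 with h | h
  · refine le_trans ?_ BetaInstance.natCast_le_roundsLB
    rw [← ENNReal.ofReal_natCast]
    refine ENNReal.ofReal_le_ofReal ?_
    calc m ^ (1 / 192 * M) ≤ m ^ (1 : ℝ) :=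
          Real.rpow_le_rpow_of_exponent_le (by linarith) (by linarith)
      _ ≤ _ := by rw [Real.rpow_one]; exact min_le_left _ _
  · refine le_trans ?_ BetaInstance.mainLB_le_roundsLB
    have hm0 : 0 < m := by linarith
    have hs : (√m)⁻¹ < 1 := inv_lt_one_of_one_lt₀ (by rw [Real.lt_sqrt (by norm_num)]; linarith)
    refine le_trans (ENNReal.ofReal_le_ofReal ?_)
      (ofReal_div_le_mainLB (x := 1 / 2) (y := 3 * m ^ (-(M / 32))) (hardInstance n hM).ae_prior
        (Fin.last n) (uniformInit_mem_stdSimplex hn) (by positivity) ?_ ?_)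
    · rw [Real.rpow_neg hm0.le, le_div_iff₀ (by positivity), ← div_eq_mul_inv, mul_div_assoc',
        div_le_iff₀ (by positivity)]
      have h6 : (6 : ℝ) ≤ m ^ (M / 64) := by
        calc (6 : ℝ) ≤ 2 ^ (3 : ℝ) := by norm_num
          _ ≤ m ^ (3 : ℝ) := Real.rpow_le_rpow (by norm_num) hm2 (by norm_num)
          _ ≤ _ := Real.rpow_le_rpow_of_exponent_le (by linarith) (by linarith)
      have h7 : m ^ (1 / 192 * M) ≤ m ^ (M / 64) :=
        Real.rpow_le_rpow_of_exponent_le (by linarith) (by linarith)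
      have h8 : m ^ (M / 32) = m ^ (M / 64) * m ^ (M / 64) := by
        rw [← Real.rpow_add hm0]
        congr 1
        ring
      rw [h8]
      nlinarith
    · rw [integral_hardInstance hn hM]
      have : 2 / M ≤ 1 / 2 := by rw [div_le_div_iff₀ (by linarith) (by norm_num)]; linarith
      linarith
    · refine (measureReal_mix_lt_le _ _ (1 - (√m)⁻¹)).trans
        (le_trans (add_le_add (measureReal_hardInstance_mix_le hn hM hs) ?_)
          (hardInstance_failure_le (by linarith) hm2 hmM hmn))
      rw [hardInstance.prior_last]
      exact betaMeasure_one_left_Ici_le (by linarith) (by positivity)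

/-! ### The event that all samples of the previous arms are zero -/

/-- The conditional probability, given the mean reward `x` of arm `i`, that arm `i` does not
prevent the event `zeros j N`. -/
noncomputable def zerosWeight {K : ℕ} (j : Fin K) (N : ℕ) (i : Fin K) (x : ℝ) : ℝ :=
  if i < j then (1 - x) ^ N else 1

theorem mem_zeros_iff {K : ℕ} {j : Fin K} {N : ℕ} {ω : Outcome K} :
    ω ∈ zeros j N ↔ ∀ i, i < j → ∀ s, s < N → ω.1 i ≤ ω.2 (i, s) := by
  simp [zeros, reward]

theorem measurableSet_zeros {K : ℕ} (j : Fin K) (N : ℕ) : MeasurableSet (zeros j N) := by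
  have : zeros j N = ⋂ i : Fin K, ⋂ (_ : i < j), ⋂ s : ℕ, ⋂ (_ : s < N),
      {ω : Outcome K | ω.1 i ≤ ω.2 (i, s)} := by
    ext ω
    simp only [Set.mem_iInter]
    exact mem_zeros_iff
  rw [this]
  refine MeasurableSet.iInter fun i => MeasurableSet.iInter fun _ => MeasurableSet.iInter fun s =>
    MeasurableSet.iInter fun _ => measurableSet_le (by fun_prop) (by fun_prop)

theorem volume_seed_ge {x : ℝ} (hx : x ∈ Set.Ioo (0 : ℝ) 1) :
    (volume : Measure unitInterval) {y | x ≤ y} = ENNReal.ofReal (1 - x) :=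
  unitInterval.volume_Ici (x := ⟨x, hx.1.le, hx.2.le⟩)

/-- For fixed means the event is a box in finitely many independent seeds, so its probability
factors over the arms; this turns conditioning on `zeros j N` into a product weight. -/
theorem measureReal_seeds {K : ℕ} (j : Fin K) (N : ℕ) {μ : Fin K → ℝ}
    (hμ : ∀ i, μ i ∈ Set.Ioo (0 : ℝ) 1) :
    (Measure.infinitePi fun _ : Fin K × ℕ => (volume : Measure unitInterval)).real
      (Prod.mk μ ⁻¹' zeros j N) = ∏ i, zerosWeight j N i (μ i) := by
  have h : Prod.mk μ ⁻¹' zeros j N =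
      Set.pi ((Finset.univ.filter (· < j) ×ˢ Finset.range N : Finset (Fin K × ℕ)) : Set _)
        fun p => {y : unitInterval | μ p.1 ≤ y} := by
    ext y
    rw [Set.mem_preimage, mem_zeros_iff]
    simp only [Set.mem_pi, Finset.mem_coe, Finset.mem_product, Finset.mem_filter,
      Finset.mem_univ, true_and, Finset.mem_range, Prod.forall]
    exact ⟨fun h i s his => h i his.1 s his.2, fun h i hi s hs => h i s ⟨hi, hs⟩⟩
  rw [h, measureReal_def, Measure.infinitePi_pi _ fun p _ =>
    measurableSet_le measurable_const measurable_subtype_coe, ENNReal.toReal_prod,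
    Finset.prod_product, Finset.prod_filter]
  refine Finset.prod_congr rfl fun i _ => ?_
  rw [zerosWeight]
  split_ifs
  · simp only [volume_seed_ge (hμ i), ENNReal.toReal_ofReal (sub_nonneg.2 (hμ i).2.le),
      Finset.prod_const, Finset.card_range]
  · rfl

section Product

variable {K : ℕ} {P : Fin K → Measure ℝ} [∀ i, IsProbabilityMeasure (P i)]

instance : IsProbabilityMeasure (model P) := by
  unfold model
  infer_instance

theorem setIntegral_zeros (hP : ∀ i, ∀ᵐ x ∂P i, x ∈ Set.Ioo (0 : ℝ) 1) (j : Fin K) (N : ℕ)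
    {g : (Fin K → ℝ) → ℝ} (hg : Integrable g (Measure.pi P)) :
    ∫ ω in zeros j N, g ω.1 ∂(model P) =
      ∫ μ, g μ * ∏ i, zerosWeight j N i (μ i) ∂(Measure.pi P) := by
  have hi : Integrable ((zeros j N).indicator fun ω : Outcome K => g ω.1) (model P) :=
    Integrable.indicator (hg.comp_fst _) (measurableSet_zeros j N)
  rw [← integral_indicator (measurableSet_zeros j N), model, integral_prod _ hi]
  refine integral_congr_ae ?_
  filter_upwards [ae_pi_mem_Ioo hP] with μ hμ
  rw [← measureReal_seeds j N hμ]
  have h : ∀ y, (zeros j N).indicator (fun ω : Outcome K => g ω.1) (μ, y) =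
      (Prod.mk μ ⁻¹' zeros j N).indicator (fun _ => g μ) y := fun y => rfl
  simp only [h]
  rw [integral_indicator_const _ (measurable_prodMk_left (measurableSet_zeros j N)), smul_eq_mul,
    mul_comm]

theorem measureReal_zeros (hP : ∀ i, ∀ᵐ x ∂P i, x ∈ Set.Ioo (0 : ℝ) 1) (j : Fin K) (N : ℕ) :
    (model P).real (zeros j N) = ∏ i, ∫ x, zerosWeight j N i x ∂(P i) := by
  have h := setIntegral_zeros hP j N (integrable_const (1 : ℝ))
  simp only [one_mul] at h
  rw [← integral_fintype_prod_eq_prod (μ := P), ← h]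
  simp

/-- The product weight keeps the arms independent a posteriori, so only the factor of arm `t`
changes, by its posterior mean `c`. -/
theorem integral_mul_prod_zerosWeight (j : Fin K) (N : ℕ) (t : Fin K) {c : ℝ}
    (hc : ∫ x, x * zerosWeight j N t x ∂(P t) = c * ∫ x, zerosWeight j N t x ∂(P t)) :
    ∫ μ, μ t * ∏ i, zerosWeight j N i (μ i) ∂(Measure.pi P) =
      c * ∏ i, ∫ x, zerosWeight j N i x ∂(P i) := by
  have h : ∀ μ : Fin K → ℝ, μ t * ∏ i, zerosWeight j N i (μ i) =
      ∏ i, (if i = t then μ i else 1) * zerosWeight j N i (μ i) := fun μ => by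
    rw [Finset.prod_mul_distrib]
    simp
  have h2 : ∀ i, ∫ x, (if i = t then x else 1) * zerosWeight j N i x ∂(P i) =
      (if i = t then c else 1) * ∫ x, zerosWeight j N i x ∂(P i) := fun i => by
    by_cases hi : i = t
    · subst hi
      simpa using hc
    · simp [hi]
  simp only [h]
  rw [integral_fintype_prod_eq_prod (μ := P)
    (fun i x => (if i = t then x else 1) * zerosWeight j N i x)]
  simp only [h2]
  rw [Finset.prod_mul_distrib]
  simp

theorem integral_cond_zeros_pos (hP : ∀ i, ∀ᵐ x ∂P i, x ∈ Set.Ioo (0 : ℝ) 1) {i j : Fin K} {N : ℕ}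
    {c d : ℝ} (hc : ∫ x, x * zerosWeight j N i x ∂(P i) = c * ∫ x, zerosWeight j N i x ∂(P i))
    (hd : ∫ x, x * zerosWeight j N j x ∂(P j) = d * ∫ x, zerosWeight j N j x ∂(P j))
    (hcd : c < d) (hpos : 0 < (model P).real (zeros j N)) :
    0 < ∫ ω, (ω.1 j - ω.1 i) ∂(ProbabilityTheory.cond (model P) (zeros j N)) := by
  have hW : ∀ t, Integrable (fun μ : Fin K → ℝ => μ t * ∏ i, zerosWeight j N i (μ i))
      (Measure.pi P) := fun t => by
    have hm : ∀ i, Measurable (zerosWeight j N i) := fun i => by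
      unfold zerosWeight
      split_ifs <;> fun_prop
    refine Integrable.of_bound (Measurable.aestronglyMeasurable (by fun_prop)) 1 ?_
    filter_upwards [ae_pi_mem_Ioo hP] with μ hμ
    have h0 : ∀ i, 0 ≤ zerosWeight j N i (μ i) := fun i => by
      unfold zerosWeight
      split_ifs
      · exact pow_nonneg (sub_nonneg.2 (hμ i).2.le) N
      · exact zero_le_one
    have h1 : ∀ i, zerosWeight j N i (μ i) ≤ 1 := fun i => by
      unfold zerosWeight
      split_ifs
      · exact pow_le_one₀ (sub_nonneg.2 (hμ i).2.le) (by linarith [(hμ i).1])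
      · exact le_rfl
    rw [Real.norm_eq_abs, abs_of_nonneg
      (mul_nonneg (hμ t).1.le (Finset.prod_nonneg fun i _ => h0 i))]
    exact mul_le_one₀ (hμ t).2.le (Finset.prod_nonneg fun i _ => h0 i)
      (Finset.prod_le_one (fun i _ => h0 i) fun i _ => h1 i)
  have h : ∫ ω in zeros j N, (ω.1 j - ω.1 i) ∂(model P) =
      (d - c) * (model P).real (zeros j N) := by
    rw [setIntegral_zeros hP j N (g := fun μ => μ j - μ i)
      ((integrable_pi_eval hP j).sub (integrable_pi_eval hP i))]
    simp only [sub_mul]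
    rw [integral_sub (hW j) (hW i), integral_mul_prod_zerosWeight j N j hd,
      integral_mul_prod_zerosWeight j N i hc, measureReal_zeros hP]
  rw [ProbabilityTheory.cond, integral_smul_measure, h, ENNReal.toReal_inv, smul_eq_mul]
  exact mul_pos (inv_pos.2 hpos) (mul_pos (sub_pos.2 hcd) hpos)

end Product

/-! ### Beta priors conditioned on zeros: `N_boot` and `p_boot` -/

theorem integral_mul_one_sub_pow_betaMeasure {a b : ℝ} (ha : 0 < a) (hb : 0 < b) (N : ℕ) :
    ∫ x, x * (1 - x) ^ N ∂betaMeasure a b =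
      a / (a + b + N) * ∫ x, (1 - x) ^ N ∂betaMeasure a b := by
  have h0 := integral_pow_betaMeasure ha hb 0 N
  have h1 := integral_pow_betaMeasure ha hb 1 N
  simp only [pow_zero, one_mul, Nat.cast_zero, add_zero, pow_one, Nat.cast_one] at h0 h1
  rw [h0, h1, beta_add_one_left ha (by positivity), add_assoc]
  ring

namespace BetaInstance

variable {K : ℕ} (I : BetaInstance K) {M : ℝ}

/-- Given the zeros, arm `i` has posterior mean `a / (a + b + N)`, while arm `j` is not observed and
keeps its prior mean. -/
theorem integral_cond_zeros_pos {i j : Fin K} (hij : i < j) {N : ℕ}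
    (hN : I.a i / (I.strength i + N) < I.mean j) (hpos : 0 < (model I.prior).real (zeros j N)) :
    0 < ∫ ω, (ω.1 j - ω.1 i) ∂(ProbabilityTheory.cond (model I.prior) (zeros j N)) := by
  refine IncentivizedExploration.integral_cond_zeros_pos I.ae_prior ?_ ?_ hN hpos
  · simp only [zerosWeight, hij, if_true]
    exact integral_mul_one_sub_pow_betaMeasure (I.a_pos i) (I.b_pos i) N
  · simp [zerosWeight, mean, priorMean]

variable (h1 : I.ParamsGeOne) (hM : ∀ i, I.strength i ≤ M)
include h1 hM

theorem eighth_rpow_le (i : Fin K) :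
    (1 / 8 : ℝ) ^ M ≤ (I.prior i).real (Set.Ici (3 / 4)) ∧
      (1 / 8 : ℝ) ^ M ≤ (I.prior i).real (Set.Iic (1 / 4)) := by
  have h := betaMeasure_anticoncentration (t := 1 / 4) (h1 i).1 (h1 i).2 (hM i) (by norm_num)
    (by norm_num)
  norm_num at h ⊢
  exact h

/-- With probability at least `8^(-M)` the mean of an arm is at most `1/4`, and then each sample is
zero with probability above `1/2`; the `K` arms multiply. -/
theorem le_measureReal_zeros (j : Fin K) (N : ℕ) :
    ((1 / 8 : ℝ) ^ M * (1 / 2) ^ N) ^ K ≤ (model I.prior).real (zeros j N) := by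
  rw [measureReal_zeros I.ae_prior]
  have hle : (1 / 8 : ℝ) ^ M * (1 / 2) ^ N ≤ 1 := by
    rcases le_or_gt 0 M with hM0 | hM0
    · exact mul_le_one₀ (Real.rpow_le_one (by norm_num) (by norm_num) hM0) (by positivity)
        (pow_le_one₀ (by norm_num) (by norm_num))
    · have := hM j
      have := I.a_pos j
      have := I.b_pos j
      unfold strength at *
      linarith
  have h : ∀ i, (1 / 8 : ℝ) ^ M * (1 / 2) ^ N ≤ ∫ x, zerosWeight j N i x ∂(I.prior i) := by
    intro i
    unfold zerosWeight
    split_ifs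
    · have hint : Integrable (fun x => (1 - x) ^ N) (I.prior i) := by
        simpa [prior] using integrable_pow_betaMeasure (I.a_pos i) (I.b_pos i) 0 N
      have hnn : 0 ≤ᵐ[I.prior i] fun x => (1 - x) ^ N :=
        (I.ae_prior i).mono fun x hx => pow_nonneg (sub_nonneg.2 hx.2.le) N
      refine le_trans ?_ (mul_meas_ge_le_integral_of_nonneg hnn hint ((1 / 2) ^ N))
      rw [mul_comm]
      refine mul_le_mul_of_nonneg_left ((I.eighth_rpow_le h1 hM i).2.trans
        (measureReal_mono fun x (hx : x ≤ 1 / 4) => ?_)) (by positivity)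
      have h2 : (1 / 2 : ℝ) ≤ 1 - x := by linarith
      exact pow_le_pow_left₀ (by norm_num) h2 N
    · simpa using hle
  calc _ = ∏ _i : Fin K, (1 / 8 : ℝ) ^ M * (1 / 2) ^ N := by simp
    _ ≤ _ := Finset.prod_le_prod (fun i _ => by positivity) fun i _ => h i

/-- Since `a_j ≥ 1`, the prior mean of arm `j` is at least `1 / M`, and `a_i ≤ M`; so more than `M ^
2` zeros push the posterior mean of arm `i` below it. -/
theorem nBoot_le : (nBoot I.prior : ℝ) ≤ M ^ 2 + 1 := by
  have hmem : nBoot I.prior ≤ ⌊M ^ 2⌋₊ + 1 := by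
    refine Nat.sInf_le fun i j hij => ?_
    -- Needed because conditioning on a null event gives the zero measure, for which the strict
    -- inequality fails.
    have hpos : 0 < (model I.prior).real (zeros j (⌊M ^ 2⌋₊ + 1)) :=
      lt_of_lt_of_le (by positivity) (I.le_measureReal_zeros h1 hM j _)
    refine I.integral_cond_zeros_pos hij ?_ hpos
    have hN : M ^ 2 < (⌊M ^ 2⌋₊ + 1 : ℕ) := by exact_mod_cast Nat.lt_floor_add_one _
    generalize ⌊M ^ 2⌋₊ + 1 = N at hN
    have hi := hM i
    have hj := hM j
    have hai := h1 i
    have haj := h1 j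
    rw [strength] at *
    rw [mean_eq, div_lt_div_iff₀ (by linarith [I.a_pos i]) (by linarith [I.a_pos j])]
    have h3 : I.a i * (I.a j + I.b j) ≤ M * M :=
      mul_le_mul (by linarith) hj (by linarith) (by linarith)
    have h4 : 1 * (I.a i + I.b i + N) ≤ I.a j * (I.a i + I.b i + N) :=
      mul_le_mul_of_nonneg_right haj.1 (by linarith)
    nlinarith
  calc (nBoot I.prior : ℝ) ≤ (⌊M ^ 2⌋₊ + 1 : ℕ) := by exact_mod_cast hmem
    _ ≤ _ := by
        push_cast
        linarith [Nat.floor_le (sq_nonneg M)]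

theorem le_pBoot [Nonempty (Fin K)] :
    ((1 / 8 : ℝ) ^ M * (1 / 2) ^ nBoot I.prior) ^ K ≤ pBoot I.prior :=
  le_ciInf fun j => I.le_measureReal_zeros h1 hM j _

end BetaInstance

/-! ### Gaps under a product prior -/

section Product

variable {K : ℕ} {P : Fin K → Measure ℝ} [∀ i, IsProbabilityMeasure (P i)]

theorem indepFun_pi_eval {i j : Fin K} (hij : i ≠ j) :
    IndepFun (fun μ : Fin K → ℝ => μ i) (fun μ => μ j) (Measure.pi P) :=
  (iIndepFun_pi (μ := P) (X := fun _ => id) fun _ => aemeasurable_id).indepFun hij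

theorem measureReal_pi_eval_and {i j : Fin K} (hij : i ≠ j) {S T : Set ℝ} (hS : MeasurableSet S)
    (hT : MeasurableSet T) :
    (Measure.pi P).real {μ | μ i ∈ S ∧ μ j ∈ T} = (P i).real S * (P j).real T := by
  rw [← measureReal_pi_eval i hS, ← measureReal_pi_eval j hT, measureReal_def, measureReal_def,
    measureReal_def, ← ENNReal.toReal_mul]
  exact congrArg _ ((indepFun_pi_eval hij).measure_inter_preimage_eq_mul S T hS hT)

theorem setIntegral_pi_eval_of_ne {i j : Fin K} (hij : i ≠ j) {S : Set ℝ} (hS : MeasurableSet S) :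
    ∫ μ in {μ | μ j ∈ S}, μ i ∂(Measure.pi P) = priorMean (P i) * (P j).real S := by
  have hm : MeasurableSet {μ : Fin K → ℝ | μ j ∈ S} := measurable_pi_apply j hS
  have h := ((indepFun_pi_eval (P := P) hij).comp measurable_id
    (measurable_const.indicator hS : Measurable (S.indicator fun _ => (1 : ℝ))))
    |>.integral_fun_mul_eq_mul_integral (measurable_pi_apply i).aestronglyMeasurable
      ((measurable_const.indicator hS).comp (measurable_pi_apply j)).aestronglyMeasurable
  have h2 : ∫ μ, ((S.indicator fun _ => (1 : ℝ)) ∘ fun μ => μ j) μ ∂(Measure.pi P) =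
      (P j).real S := by
    have h3 : ((S.indicator fun _ => (1 : ℝ)) ∘ fun μ : Fin K → ℝ => μ j) =
      {μ : Fin K → ℝ | μ j ∈ S}.indicator 1 := rfl
    rw [h3, integral_indicator_one hm, measureReal_pi_eval j hS]
  rw [h2] at h
  simp only [Function.comp_apply, id] at h
  rw [integral_pi_eval] at h
  rw [← h, ← integral_indicator hm]
  refine integral_congr_ae (Filter.Eventually.of_forall fun μ => ?_)
  by_cases hμ : μ j ∈ S
  · simp [hμ]
  · simp [hμ]

variable (hP : ∀ i, ∀ᵐ x ∂P i, x ∈ Set.Ioo (0 : ℝ) 1)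

include hP

theorem mul_measureReal_le_integral_max {f : (Fin K → ℝ) → ℝ} {A : Set (Fin K → ℝ)} {c : ℝ}
    (hc : 0 ≤ c) (hf : Integrable f (Measure.pi P))
    (hA : ∀ μ ∈ A, (∀ i, μ i ∈ Set.Ioo (0 : ℝ) 1) → c ≤ f μ) :
    c * (Measure.pi P).real A ≤ ∫ μ, max (f μ) 0 ∂(Measure.pi P) := by
  refine le_trans (mul_le_mul_of_nonneg_left ?_ hc) (mul_meas_ge_le_integral_of_nonneg
    (Filter.Eventually.of_forall fun μ => le_max_right (f μ) 0) hf.pos_part c)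
  rw [measureReal_def, measureReal_def]
  refine ENNReal.toReal_mono (measure_ne_top _ _) (measure_mono_ae ?_)
  filter_upwards [ae_pi_mem_Ioo hP] with μ hμ hA'
  exact (hA μ hA' hμ).trans (le_max_left _ _)

/-- Jensen's inequality for the mixture, on the event that arm `j` is good. -/
theorem mul_measureReal_Ici_le_integral_max {j : Fin K} {q : Fin K → ℝ}
    (hqj : q j = 0) (t : ℝ) :
    (t - ∑ i, q i * priorMean (P i)) * (P j).real (Set.Ici t) ≤
      ∫ μ, max (μ j - mix q μ) 0 ∂(Measure.pi P) := by
  have hf : Integrable (fun μ => μ j - mix q μ) (Measure.pi P) :=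
    (integrable_pi_eval hP j).sub (integrable_mix hP q)
  set A : Set (Fin K → ℝ) := {μ | μ j ∈ Set.Ici t} with hA
  have hAm : MeasurableSet A := measurable_pi_apply j measurableSet_Ici
  have h1 : ∫ μ in A, (t - mix q μ) ∂(Measure.pi P) =
      (t - ∑ i, q i * priorMean (P i)) * (P j).real (Set.Ici t) := by
    rw [integral_sub (integrable_const _).integrableOn (integrable_mix hP q).integrableOn]
    unfold mix
    rw [integral_finsetSum _ fun i _ => ((integrable_pi_eval hP i).const_mul _).integrableOn,
      sub_mul, Finset.sum_mul]
    congr 1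
    · rw [setIntegral_const, hA, measureReal_pi_eval j measurableSet_Ici, smul_eq_mul, mul_comm]
    · refine Finset.sum_congr rfl fun i _ => ?_
      rw [integral_const_mul]
      by_cases hi : i = j
      · rw [hi, hqj]
        simp
      · rw [setIntegral_pi_eval_of_ne hi measurableSet_Ici]
        ring
  rw [← h1]
  calc _ ≤ ∫ μ in A, max (μ j - mix q μ) 0 ∂(Measure.pi P) := by
        refine setIntegral_mono_on ((integrable_const t).sub (integrable_mix hP q)).integrableOn
          hf.pos_part.integrableOn hAm fun μ hμ => le_max_of_le_left ?_
        exact sub_le_sub_right hμ _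
    _ ≤ _ := setIntegral_le_integral hf.pos_part
        (Filter.Eventually.of_forall fun μ => le_max_right _ _)

end Product

/-! ### Lower bounds for `ε_TS`, `δ_TS` and `G_pad` under Beta priors -/

namespace BetaInstance

variable {K : ℕ} (I : BetaInstance K) {M : ℝ} (h1 : I.ParamsGeOne) (hM : ∀ i, I.strength i ≤ M)
include h1 hM

theorem le_epsTS (hK : 2 ≤ K) : 1 / 2 * ((1 / 8 : ℝ) ^ M * (1 / 8) ^ M) ≤ epsTS I.prior := by
  -- Two arms make the set nonempty; the real infimum of the empty set would be 0.
  refine le_csInf ⟨_, ⟨0, by omega⟩, ⟨1, by omega⟩, by simp, rfl⟩ ?_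
  rintro x ⟨i, j, hij, rfl⟩
  refine le_trans ?_ (mul_measureReal_le_integral_max I.ae_prior (c := 1 / 2)
    (A := {μ | μ i ∈ Set.Ici (3 / 4 : ℝ) ∧ μ j ∈ Set.Iic (1 / 4 : ℝ)}) (by norm_num)
    ((integrable_pi_eval I.ae_prior i).sub (integrable_pi_eval I.ae_prior j)) ?_)
  · rw [measureReal_pi_eval_and hij measurableSet_Ici measurableSet_Iic]
    have h2 := (I.eighth_rpow_le h1 hM i).1
    have h3 := (I.eighth_rpow_le h1 hM j).2
    gcongr
  · rintro μ ⟨hi, hj⟩ -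
    have hi' : (3 / 4 : ℝ) ≤ μ i := hi
    have hj' : μ j ≤ (1 / 4 : ℝ) := hj
    linarith

/-- Arm `i` is best whenever it is above `3/4` and all the others are below `1/4`, a product event.
-/
theorem le_deltaTS [Nonempty (Fin K)] : ((1 / 8 : ℝ) ^ M) ^ K ≤ deltaTS I.prior := by
  refine le_ciInf fun i => ?_
  set S : Fin K → Set ℝ := fun j => if j = i then Set.Ici (3 / 4) else Set.Iic (1 / 4) with hS
  have hsub : Set.pi Set.univ S ⊆ {μ | IsBestArm μ i} := by
    intro μ hμ
    have hi : (3 / 4 : ℝ) ≤ μ i := by simpa [hS] using hμ i (Set.mem_univ _)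
    have hj : ∀ j, j ≠ i → μ j ≤ (1 / 4 : ℝ) := fun j hj => by
      simpa [hS, hj] using hμ j (Set.mem_univ _)
    refine ⟨fun j => ?_, fun j hji => ?_⟩
    · by_cases h : j = i
      · rw [h]
      · linarith [hj j h]
    · linarith [hj j hji.ne]
  calc ((1 / 8 : ℝ) ^ M) ^ K = ∏ _j : Fin K, (1 / 8 : ℝ) ^ M := by simp
    _ ≤ ∏ j, (I.prior j).real (S j) := by
        refine Finset.prod_le_prod (fun j _ => by positivity) fun j _ => ?_
        by_cases h : j = i
        · simp only [hS, h, if_true]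
          exact (I.eighth_rpow_le h1 hM i).1
        · simp only [hS, h, if_false]
          exact (I.eighth_rpow_le h1 hM j).2
    _ = (Measure.pi I.prior).real (Set.pi Set.univ S) := by
        simp only [measureReal_def]
        rw [Measure.pi_pi, ENNReal.toReal_prod]
    _ ≤ _ := measureReal_mono hsub

theorem mean_le (i : Fin K) : I.mean i ≤ 1 - 1 / M := by
  have ha := I.a_pos i
  have hb := (h1 i).2
  have h := hM i
  rw [strength] at h
  have h2 : I.mean i ≤ 1 - 1 / (I.a i + I.b i) := by
    rw [mean_eq, div_le_iff₀ (by linarith), sub_mul, div_mul_cancel₀ _ (by linarith)]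
    linarith
  have h3 : 1 / M ≤ 1 / (I.a i + I.b i) := one_div_le_one_div_of_le (by linarith) h
  linarith

/-- The mixture has mean at most `1 - 1/M` and is independent of arm `j`; the threshold `1 - 1/(2M)`
for arm `j` leaves a gap `1/(2M)`. No factor depends on `K`. -/
theorem le_integral_of_strength (hM2 : 2 ≤ M) {j : Fin K} {q : Fin K → ℝ}
    (hq : q ∈ stdSimplex ℝ (Fin K)) (hqj : q j = 0) :
    1 / (2 * M) * (1 / (4 * M)) ^ M ≤ ∫ μ, max (μ j - mix q μ) 0 ∂(Measure.pi I.prior) := by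
  refine le_trans ?_ (mul_measureReal_Ici_le_integral_max I.ae_prior hqj (1 - 1 / (2 * M)))
  have hsum : ∑ i, q i * priorMean (I.prior i) ≤ 1 - 1 / M := by
    calc _ ≤ ∑ i, q i * (1 - 1 / M) := Finset.sum_le_sum fun i _ =>
          mul_le_mul_of_nonneg_left (I.mean_le h1 hM i) (hq.1 i)
      _ = _ := by rw [← Finset.sum_mul, hq.2, one_mul]
  have hM' : 1 / M = 2 * (1 / (2 * M)) := by field_simp
  have ht : 1 / (2 * M) ≤ 1 / 2 := one_div_le_one_div_of_le (by norm_num) (by linarith)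
  have htail := (betaMeasure_anticoncentration (t := 1 / (2 * M)) (h1 j).1 (h1 j).2 (hM j)
    (by positivity) ht).1
  rw [show 1 / (2 * M) / 2 = 1 / (4 * M) by field_simp; norm_num] at htail
  exact mul_le_mul (by linarith) htail (by positivity)
    (by linarith [show 0 < 1 / (2 * M) by positivity])

theorem le_integral_of_card (hK : 2 ≤ K) {j : Fin K} {q : Fin K → ℝ}
    (hq : q ∈ stdSimplex ℝ (Fin K)) (hqj : q j = 0) :
    1 / (4 * K) * ((1 / (4 * K)) ^ M * (1 / 8) ^ M) ≤
      ∫ μ, max (μ j - mix q μ) 0 ∂(Measure.pi I.prior) := by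
  have hK2 : (2 : ℝ) ≤ K := by exact_mod_cast hK
  -- Pigeonhole. Below `1/4`, this arm alone keeps the mixture at most `1 - 3/(4K)`, while arm `j`
  -- reaches `1 - 1/(2K)`: the gap is `1/(4K)`.
  obtain ⟨i, -, hi⟩ : ∃ i ∈ Finset.univ, (1 / K : ℝ) ≤ q i := by
    refine Finset.exists_le_of_sum_le ⟨j, Finset.mem_univ j⟩ ?_
    rw [hq.2]
    simp only [Finset.sum_const, Finset.card_univ, Fintype.card_fin, nsmul_eq_mul]
    rw [mul_one_div_cancel (by positivity)]
  have hji : j ≠ i := by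
    rintro rfl
    have : (0 : ℝ) < 1 / K := by positivity
    linarith
  have ht : 1 / (2 * (K : ℝ)) ≤ 1 / 2 := one_div_le_one_div_of_le (by norm_num) (by linarith)
  have htail := (betaMeasure_anticoncentration (t := 1 / (2 * (K : ℝ))) (h1 j).1 (h1 j).2 (hM j)
    (by positivity) ht).1
  rw [show 1 / (2 * (K : ℝ)) / 2 = 1 / (4 * K) by field_simp; norm_num] at htail
  refine le_trans ?_ (mul_measureReal_le_integral_max I.ae_prior (c := 1 / (4 * K))
    (A := {μ | μ j ∈ Set.Ici (1 - 1 / (2 * K) : ℝ) ∧ μ i ∈ Set.Iic (1 / 4 : ℝ)}) (by positivity)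
    ((integrable_pi_eval I.ae_prior j).sub (integrable_mix I.ae_prior q)) ?_)
  · rw [measureReal_pi_eval_and hji measurableSet_Ici measurableSet_Iic]
    have h3 := (I.eighth_rpow_le h1 hM i).2
    refine mul_le_mul_of_nonneg_left ?_ (by positivity)
    exact mul_le_mul htail h3 (by positivity) measureReal_nonneg
  · rintro μ ⟨hj, hi4⟩ hμ
    have hj' : (1 - 1 / (2 * K) : ℝ) ≤ μ j := hj
    have hi' : μ i ≤ (1 / 4 : ℝ) := hi4
    have hmix : q i * (1 - μ i) ≤ 1 - mix q μ := by
      have : 1 - mix q μ = ∑ l, q l * (1 - μ l) := by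
        simp only [mix, mul_sub, mul_one, Finset.sum_sub_distrib, hq.2]
      rw [this]
      exact Finset.single_le_sum (f := fun l => q l * (1 - μ l))
        (fun l _ => mul_nonneg (hq.1 l) (sub_nonneg.2 (hμ l).2.le)) (Finset.mem_univ i)
    have h34 : 1 / K * (3 / 4) ≤ q i * (1 - μ i) :=
      mul_le_mul hi (by linarith) (by norm_num) (hq.1 i)
    have e1 : 1 / (2 * (K : ℝ)) = 2 * (1 / (4 * K)) := by field_simp; norm_num
    have e2 : 1 / (K : ℝ) = 4 * (1 / (4 * K)) := by field_simp
    rw [e1] at hj'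
    rw [e2] at h34
    linarith

theorem le_gPad (hK : 2 ≤ K) (hM2 : 2 ≤ M) :
    1 / (4 * min (K : ℝ) M) * ((1 / (4 * min (K : ℝ) M)) ^ M * (1 / 8) ^ M) ≤ gPad I.prior := by
  refine le_csInf ⟨_, ⟨1, by omega⟩, Pi.single ⟨0, by omega⟩ 1, single_mem_stdSimplex ℝ _,
    fun i hi => Pi.single_eq_of_ne ?_ _, rfl⟩ ?_
  · rintro rfl
    simp at hi
  · rintro x ⟨j, q, hq, hqj, rfl⟩
    rcases le_total (K : ℝ) M with h | h
    · rw [min_eq_left h]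
      exact I.le_integral_of_card h1 hM hK hq (hqj j le_rfl)
    · rw [min_eq_right h]
      refine le_trans ?_ (I.le_integral_of_strength h1 hM hM2 hq (hqj j le_rfl))
      have h4 : 1 / (4 * M) ≤ 1 / (2 * M) :=
        one_div_le_one_div_of_le (by linarith) (by linarith)
      have h8 : (1 / 8 : ℝ) ^ M ≤ 1 := Real.rpow_le_one (by norm_num) (by norm_num) (by linarith)
      exact mul_le_mul h4 (mul_le_of_le_one_right (by positivity) h8) (by positivity)
        (by positivity)

end BetaInstance

/-! ### The upper bound -/

theorem le_two_rpow_self {M : ℝ} (hM : 1 ≤ M) : M ≤ 2 ^ M := by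
  have h := one_add_mul_self_le_rpow_one_add (s := 1) (by norm_num) hM
  norm_num at h
  linarith

theorem eighth_rpow_eq (M : ℝ) : (1 / 8 : ℝ) ^ M = (((2 : ℝ) ^ M) ^ 3)⁻¹ := by
  rw [← Real.rpow_natCast, ← Real.rpow_mul (by norm_num), mul_comm M, Real.rpow_mul (by norm_num),
    ← Real.inv_rpow (by norm_num)]
  norm_num

theorem log_inv_eighth_rpow_pow_le {M x : ℝ} (hM : 0 ≤ M) (K N : ℕ)
    (hx : ((1 / 8 : ℝ) ^ M * (1 / 2) ^ N) ^ K ≤ x) :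
    Real.log x⁻¹ ≤ K * (3 * M + N) := by
  have hl2 : Real.log 2 ≤ 1 := by linarith [Real.log_two_lt_d9]
  have hpos : 0 < ((1 / 8 : ℝ) ^ M * (1 / 2) ^ N) ^ K := by positivity
  have h := Real.log_le_log hpos hx
  have h8 : Real.log (1 / 8) = -(3 * Real.log 2) := by
    rw [one_div, Real.log_inv, show (8 : ℝ) = 2 ^ 3 by norm_num, Real.log_pow]
    norm_num
  have h2 : Real.log (1 / 2) = -Real.log 2 := by rw [one_div, Real.log_inv]
  rw [Real.log_pow, Real.log_mul (by positivity) (by positivity), Real.log_rpow (by norm_num),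
    Real.log_pow, h8, h2] at h
  rw [Real.log_inv]
  have h3 : (K : ℝ) * (3 * M + N) * Real.log 2 ≤ K * (3 * M + N) * 1 :=
    mul_le_mul_of_nonneg_left hl2 (by positivity)
  linarith

/-- The parameters of the upper bound are polynomial in `m ^ M`, where `m = min K M`,
up to linear factors `K`. -/
theorem roundsUB_arith {K N : ℕ} {M m cTS cPad cUB ε δ G p : ℝ} (hK : 2 ≤ K) (hM : 2 ≤ M)
    (hm : 2 ≤ m) (hcTS : 0 < cTS) (hcPad : 0 < cPad) (hcUB : 0 < cUB)
    (hε : 1 / 2 * ((1 / 8 : ℝ) ^ M * (1 / 8) ^ M) ≤ ε) (hδ : ((1 / 8 : ℝ) ^ M) ^ K ≤ δ)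
    (hG : 1 / (4 * m) * ((1 / (4 * m)) ^ M * (1 / 8) ^ M) ≤ G) (hN : (N : ℝ) ≤ M ^ 2 + 1)
    (hp : ((1 / 8 : ℝ) ^ M * (1 / 2) ^ N) ^ K ≤ p) :
    cUB * K * max (cTS * ε⁻¹ ^ 2 * Real.log δ⁻¹) (max (N : ℝ) (cPad * G⁻¹ ^ 2 * Real.log G⁻¹)) *
      G⁻¹ * Real.log (G⁻¹ * p⁻¹) ≤ cUB * (1 + cTS + cPad) * (K ^ 3 * (m ^ M) ^ 41) := by
  have hK1 : (1 : ℝ) ≤ K := by exact_mod_cast (by omega : 1 ≤ K)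
  set R := m ^ M with hR
  have h2R : (2 : ℝ) ^ M ≤ R := Real.rpow_le_rpow (by norm_num) hm (by linarith)
  have hMR : M ≤ R := (le_two_rpow_self (by linarith)).trans h2R
  have hm2R : m ^ 2 ≤ R := by
    rw [← Real.rpow_natCast]
    exact Real.rpow_le_rpow_of_exponent_le (by linarith) (by exact_mod_cast hM)
  have hR4 : 4 ≤ R := by nlinarith
  have hR0 : 0 < R := by linarith
  have h8R : (R ^ 3)⁻¹ ≤ (1 / 8 : ℝ) ^ M := by
    rw [eighth_rpow_eq]
    gcongr
  have hpow : ∀ a b : ℕ, a ≤ b → R ^ a ≤ R ^ b := fun a b hab =>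
    pow_le_pow_right₀ (by linarith) hab
  -- Each `8^(-M)` costs `R ^ 3`, and the `1/2` costs one more `R`.
  have hε' : ε⁻¹ ≤ R ^ 7 := by
    refine inv_le_of_inv_le₀ (by positivity) (le_trans ?_ hε)
    calc (R ^ 7)⁻¹ = R⁻¹ * ((R ^ 3)⁻¹ * (R ^ 3)⁻¹) := by field_simp
      _ ≤ 1 / 2 * ((1 / 8 : ℝ) ^ M * (1 / 8) ^ M) := by
          have : R⁻¹ ≤ 1 / 2 := by rw [one_div]; exact inv_anti₀ (by norm_num) (by linarith)
          gcongr
  have hε0 : 0 < ε := lt_of_lt_of_le (by positivity) hε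
  have hG0 : 0 < G := lt_of_lt_of_le (by positivity) hG
  have hp0 : 0 < p := lt_of_lt_of_le (by positivity) hp
  -- From `4 ≤ m ^ 2`, `(4 * m) ^ M ≤ R ^ 3`; the prefactor `4 * m` costs `R ^ 2` and `8 ^ M` costs
  -- `R ^ 3`.
  have hG' : G⁻¹ ≤ R ^ 8 := by
    refine inv_le_of_inv_le₀ (by positivity) (le_trans ?_ hG)
    have h4m : (m ^ 3)⁻¹ ≤ 1 / (4 * m) := by
      rw [one_div]
      exact inv_anti₀ (by positivity) (by nlinarith)
    have hmR : (R ^ 2)⁻¹ ≤ 1 / (4 * m) := by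
      rw [one_div]
      refine inv_anti₀ (by positivity) ?_
      nlinarith
    have h4mM : (R ^ 3)⁻¹ ≤ (1 / (4 * m)) ^ M := by
      calc (R ^ 3)⁻¹ = ((m ^ 3)⁻¹) ^ M := by
            rw [hR, Real.inv_rpow (by positivity), ← Real.rpow_natCast, ← Real.rpow_natCast,
              ← Real.rpow_mul (by linarith), ← Real.rpow_mul (by linarith), mul_comm]
        _ ≤ _ := Real.rpow_le_rpow (by positivity) h4m (by linarith)
    calc (R ^ 8)⁻¹ = (R ^ 2)⁻¹ * ((R ^ 3)⁻¹ * (R ^ 3)⁻¹) := by field_simp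
      _ ≤ _ := by gcongr
  have hlogδ : Real.log δ⁻¹ ≤ K * R ^ 2 := by
    have h := log_inv_eighth_rpow_pow_le (M := M) (x := δ) (by linarith) K 0 (by simpa using hδ)
    rw [Nat.cast_zero, add_zero] at h
    refine h.trans (mul_le_mul_of_nonneg_left ?_ (by positivity))
    nlinarith
  have hlogG : Real.log G⁻¹ ≤ R ^ 8 := (Real.log_le_self (by positivity)).trans hG'
  have hNR : (N : ℝ) ≤ R ^ 3 := by nlinarith
  have hlogp : Real.log p⁻¹ ≤ K * (R ^ 2 + R ^ 3) := by
    refine (log_inv_eighth_rpow_pow_le (by linarith) K N hp).trans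
      (mul_le_mul_of_nonneg_left ?_ (by positivity))
    nlinarith
  have hmax : max (cTS * ε⁻¹ ^ 2 * Real.log δ⁻¹)
      (max (N : ℝ) (cPad * G⁻¹ ^ 2 * Real.log G⁻¹)) ≤ (1 + cTS + cPad) * (K * R ^ 24) := by
    have h24 : R ^ 24 ≤ K * R ^ 24 := le_mul_of_one_le_left (by positivity) hK1
    have hKR : 0 < K * R ^ 24 := by positivity
    refine max_le ?_ (max_le ?_ ?_)
    · calc _ ≤ cTS * ε⁻¹ ^ 2 * (K * R ^ 2) := mul_le_mul_of_nonneg_left hlogδ (by positivity)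
        _ ≤ cTS * (R ^ 7) ^ 2 * (K * R ^ 2) := by gcongr
        _ = cTS * (K * R ^ 16) := by ring
        _ ≤ cTS * (K * R ^ 24) := by
            have := hpow 16 24 (by norm_num)
            gcongr
        _ ≤ _ := mul_le_mul_of_nonneg_right (by linarith) hKR.le
    · calc (N : ℝ) ≤ 1 * (K * R ^ 24) := by linarith [hpow 3 24 (by norm_num)]
        _ ≤ _ := mul_le_mul_of_nonneg_right (by linarith) hKR.le
    · calc _ ≤ cPad * G⁻¹ ^ 2 * R ^ 8 := mul_le_mul_of_nonneg_left hlogG (by positivity)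
        _ ≤ cPad * (R ^ 8) ^ 2 * R ^ 8 := by gcongr
        _ = cPad * R ^ 24 := by ring
        _ ≤ cPad * (K * R ^ 24) := by gcongr
        _ ≤ _ := mul_le_mul_of_nonneg_right (by linarith) hKR.le
  have hlog : Real.log (G⁻¹ * p⁻¹) ≤ K * R ^ 9 := by
    rw [Real.log_mul (by positivity) (by positivity)]
    have e1 : R ^ 8 ≤ K * R ^ 8 := le_mul_of_one_le_left (by positivity) hK1
    have e2 : K * R ^ 2 ≤ K * R ^ 8 := by
      have := hpow 2 8 (by norm_num)
      gcongr
    have e3 : K * R ^ 3 ≤ K * R ^ 8 := by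
      have := hpow 3 8 (by norm_num)
      gcongr
    have e4 : K * R ^ 8 * 4 ≤ K * R ^ 8 * R := mul_le_mul_of_nonneg_left hR4 (by positivity)
    have e5 : 0 < K * R ^ 8 := by positivity
    calc _ ≤ R ^ 8 + K * (R ^ 2 + R ^ 3) := add_le_add hlogG hlogp
      _ ≤ K * R ^ 8 * R := by linarith
      _ = _ := by ring
  have hmax0 : 0 ≤ max (cTS * ε⁻¹ ^ 2 * Real.log δ⁻¹)
      (max (N : ℝ) (cPad * G⁻¹ ^ 2 * Real.log G⁻¹)) :=
    le_max_of_le_right (le_max_of_le_left (Nat.cast_nonneg N))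
  -- The exponent is `41 = 24 + 8 + 9`. The three factors `K` come from the prefactor, the maximum
  -- (through `log δ⁻¹`) and the final logarithm (through `log p⁻¹`).
  refine (mul_le_mul_of_nonneg_left hlog (by positivity)).trans ?_
  calc _ ≤ cUB * K * ((1 + cTS + cPad) * (K * R ^ 24)) * R ^ 8 * (K * R ^ 9) := by gcongr
    _ = _ := by ring

theorem BetaInstance.roundsUB_le {cTS cPad cUB : ℝ} (hcTS : 0 < cTS) (hcPad : 0 < cPad)
    (hcUB : 0 < cUB) {D : ℕ} (hD : cUB * (1 + cTS + cPad) ≤ 2 ^ D) {K : ℕ} {M : ℝ}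
    (I : BetaInstance K) (hK : 2 ≤ K) (h1 : I.ParamsGeOne) (hM : ∀ i, I.strength i ≤ M) :
    roundsUB cPad cUB I.prior (nTS cTS I.prior) ≤
      (K : ℝ) ^ 3 * (min (K : ℝ) M) ^ ((D + 41 : ℝ) * M) := by
  have hK2 : (2 : ℝ) ≤ K := by exact_mod_cast hK
  have hM2 : 2 ≤ M := by
    have h := hM ⟨0, by omega⟩
    have h' := h1 ⟨0, by omega⟩
    rw [BetaInstance.strength] at h
    linarith
  have : Nonempty (Fin K) := ⟨⟨0, by omega⟩⟩
  have hm : 2 ≤ min (K : ℝ) M := le_min hK2 hM2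
  refine (roundsUB_arith hK hM2 hm hcTS hcPad hcUB (I.le_epsTS h1 hM hK) (I.le_deltaTS h1 hM)
    (I.le_gPad h1 hM hK hM2) (I.nBoot_le h1 hM) (I.le_pBoot h1 hM)).trans ?_
  set m := min (K : ℝ) M
  have hR2 : (2 : ℝ) ≤ m ^ M := by
    calc (2 : ℝ) ≤ m ^ (1 : ℝ) := by rwa [Real.rpow_one]
      _ ≤ m ^ M := Real.rpow_le_rpow_of_exponent_le (by linarith) (by linarith)
  -- The multiplicative constant moves into the exponent, which is possible because `m ^ M ≥ 2`.
  have hDR : cUB * (1 + cTS + cPad) ≤ (m ^ M) ^ D :=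
    hD.trans (pow_le_pow_left₀ (by norm_num) hR2 D)
  have hexp : m ^ ((D + 41 : ℝ) * M) = (m ^ M) ^ D * (m ^ M) ^ 41 := by
    rw [← pow_add, ← Real.rpow_natCast, ← Real.rpow_mul (by linarith), mul_comm]
    push_cast
    rfl
  rw [hexp]
  have h41 : 0 ≤ (K : ℝ) ^ 3 * (m ^ M) ^ 41 := by positivity
  calc _ ≤ (m ^ M) ^ D * (K ^ 3 * (m ^ M) ^ 41) := mul_le_mul_of_nonneg_right hDR h41
    _ = _ := by ring

end IncentivizedExploration

theorem corollary5p6 :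
    -- part (a)
    (∀ cTS cPad cUB : ℝ, 0 < cTS → 0 < cPad → 0 < cUB →
      ∃ C : ℝ, 0 < C ∧
        ∀ (K : ℕ) (M : ℝ) (I : IncentivizedExploration.BetaInstance K),
          2 ≤ K → I.ParamsGeOne → (∀ i, I.strength i ≤ M) →
          IncentivizedExploration.roundsUB cPad cUB I.prior
              (IncentivizedExploration.nTS cTS I.prior)
            ≤ (K : ℝ) ^ 3 * (min (K : ℝ) M) ^ (C * M)) ∧
    -- part (b)
    (∃ c : ℝ, 0 < c ∧
      ∀ (K : ℕ) (M : ℝ), 2 ≤ K → 2 ≤ M →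
        ∃ I : IncentivizedExploration.BetaInstance K, I.ParamsGeOne ∧ I.IsStrong M ∧
          ENNReal.ofReal ((min (K : ℝ) M) ^ (c * M))
            ≤ IncentivizedExploration.roundsLB I.prior) ∧
    -- part (c): for every constant gap, first for strong instances, then in general
    (∀ gap : ℝ, 0 < gap →
      ∃ c : ℝ, 0 < c ∧
        (∀ (K : ℕ) (hK : 2 ≤ K) (M : ℝ) (I : IncentivizedExploration.BetaInstance K),
          I.IsStrong M →
          gap ≤ I.mean ⟨0, by omega⟩ - I.mean ⟨K - 1, by omega⟩ →
          ENNReal.ofReal ((2 : ℝ) ^ (c * M)) ≤ IncentivizedExploration.roundsLB I.prior) ∧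
        (∀ (K : ℕ) (M : ℝ) (I : IncentivizedExploration.BetaInstance K) (i j : Fin K),
          i ≠ j → M ≤ I.strength i → M ≤ I.strength j → gap ≤ |I.mean i - I.mean j| →
          ENNReal.ofReal ((2 : ℝ) ^ (c * M)) ≤ IncentivizedExploration.roundsLB I.prior)) := by
  refine ⟨fun cTS cPad cUB hcTS hcPad hcUB => ?_, ⟨1 / 192, by norm_num, fun K M hK hM => ?_⟩,
    fun gap hgap => ?_⟩
  · obtain ⟨D, hD⟩ := pow_unbounded_of_one_lt (cUB * (1 + cTS + cPad)) (by norm_num : (1 : ℝ) < 2)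
    exact ⟨D + 41, by positivity, fun K M I hK h1 hM =>
      I.roundsUB_le hcTS hcPad hcUB hD.le hK h1 hM⟩
  · obtain ⟨n, rfl⟩ : ∃ n, K = n + 1 := ⟨K - 1, by omega⟩
    exact ⟨IncentivizedExploration.hardInstance n hM,
      IncentivizedExploration.hardInstance.paramsGeOne hM,
      IncentivizedExploration.hardInstance.isStrong hM,
      IncentivizedExploration.rpow_le_roundsLB_hardInstance (by omega) hM⟩
  · have hc : 0 < gap ^ 2 / 32 / (2 * (|Real.log (2 / gap)| + gap / 8 + 1)) := by positivity
    refine ⟨_, hc, fun K hK M I hI hg => ?_, fun K M I i j hij hi hj hg => ?_⟩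
    · refine I.two_rpow_le_roundsLB hgap (i := ⟨0, by omega⟩) (j := ⟨K - 1, by omega⟩) ?_
        (hI _).ge (hI _).ge (hg.trans (le_abs_self _))
      intro h
      have := Fin.mk.inj_iff.1 h
      omega
    · exact I.two_rpow_le_roundsLB hgap hij hi hj hg
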